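/- **Lemma 4.2.** All graphs are finite and simple. The *cube* $P_3(T)$ of a graph $T$ is the graph on the vertex set of $T$ in which two distinct vertices are adjacent if and only if their distance in $T$ is at most $3$; let $\mathbb{C}$ be the class of all graphs isomorphic to $P_3(T)$ for some tree $T$. The *deck* of a graph $G$ is the multiset of its cards, that is, of the isomorphism classes of the vertex-deleted subgraphs $G-v$, one for each vertex $v$ of $G$. Then $\mathbb{C}$ is recognizable: membership in $\mathbb{C}$ is determined by the deck. That is, if $G$ and $H$ are graphs with the same deck and $G$ has at least three vertices, then $G\in\mathbb{C}$ if and only if $H\in\mathbb{C}$. -/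

import Mathlib

namespace TreeCube

universe u v

/-- The `k`-th power `P_k(G)`: the graph on the same vertices in which two distinct vertices are
adjacent iff their distance in `G` is at most `k` (vertices in different components of `G` are at
distance `⊤`, hence not adjacent). -/
def power {V : Type u} (G : SimpleGraph V) (k : ℕ) : SimpleGraph V where
  Adj x y := x ≠ y ∧ G.edist x y ≤ k
  symm := ⟨fun x y h => ⟨h.1.symm, by rw [SimpleGraph.edist_comm]; exact h.2⟩⟩
  loopless := ⟨fun _ h => h.1 rfl⟩

/-- Membership in the class of all graphs that are isomorphic to the third power of some tree. -/
def IsCubeOfTree {V : Type u} (G : SimpleGraph V) : Prop :=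
  ∃ (U : Type u) (T : SimpleGraph U), T.IsTree ∧ Nonempty (G ≃g power T 3)

/-- Isomorphism of labelled graphs on the vertex sets `{0, …, n - 1}`, `n : ℕ`. -/
def isoSetoid : Setoid (Σ n : ℕ, SimpleGraph (Fin n)) where
  r A B := Nonempty (A.2 ≃g B.2)
  iseqv :=
    { refl := fun _ => ⟨SimpleGraph.Iso.refl⟩
      symm := fun ⟨e⟩ => ⟨e.symm⟩
      trans := fun ⟨e⟩ ⟨f⟩ => ⟨e.trans f⟩ }

/-- A finite unlabelled graph: an isomorphism class of finite graphs. -/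
def UnlabelledGraph : Type := Quotient isoSetoid

/-- The unlabelled graph (isomorphism class) of a graph on an arbitrary finite vertex type. -/
noncomputable def unlabelled {V : Type u} [Finite V] (G : SimpleGraph V) : UnlabelledGraph :=
  Quotient.mk isoSetoid ⟨Nat.card V, G.map (Finite.equivFin V).toEmbedding⟩

/-- Two finite graphs have the same underlying unlabelled graph iff they are isomorphic. -/
theorem unlabelled_eq_iff {V : Type u} {W : Type v} [Finite V] [Finite W]
    (G : SimpleGraph V) (H : SimpleGraph W) :
    unlabelled G = unlabelled H ↔ Nonempty (G ≃g H) := by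
  have eG := SimpleGraph.Iso.map (Finite.equivFin V) G
  have eH := SimpleGraph.Iso.map (Finite.equivFin W) H
  refine Quotient.eq.trans ⟨?_, ?_⟩
  · rintro ⟨e⟩
    exact ⟨(eG.trans e).trans eH.symm⟩
  · rintro ⟨e⟩
    exact ⟨(eG.symm.trans e).trans eH⟩

/-- The card of `G` at `x`: the unlabelled graph obtained by deleting the vertex `x` together with
all edges at `x`. -/
noncomputable def card {V : Type u} [Finite V] (G : SimpleGraph V) (x : V) : UnlabelledGraph :=
  unlabelled (G.induce {y : V | y ≠ x})

/-- The deck of `G`: the multiset of all cards of `G`, one for each vertex. -/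
noncomputable def deck {V : Type u} [Fintype V] (G : SimpleGraph V) : Multiset UnlabelledGraph :=
  (Finset.univ : Finset V).val.map (card G)

end TreeCube

/-! Let `G` be the cube of a tree `T`, and let `H` have the same deck. Counting the cliques that
contain a vertex (Kelly's lemma) shows that a matching of the cards preserves degrees, and
simpliciality at non-universal vertices. If there is a universal vertex, its card determines the
whole graph. Otherwise `T` has diameter at least 7, since its centre would be universal. Simplicial
vertices of such a cube are leaves of the root whose siblings all are leaves (`endLeaf_of_simp`), so
the cards of `H` at simplicial vertices are again cubes of trees, and `H` has two simplicial
vertices `v₁`, `v₂` that are neither adjacent nor joined by a common neighbour.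

Let `T₁`, `T₂` be roots of `H - v₁` and `H - v₂`. Both restrict to roots of `H - v₁ - v₂`, and `v₁`
has to be hung on `T₁` as it hangs on `T₂`. The obstacle is that cube roots are not unique. If `v₁`
has a sibling leaf in `T₂`, it is a twin of it and joins it in `T₁`. Otherwise the parent `y` of
`v₁` becomes a leaf at some `z`, and the neighbourhood of `v₁` is the unit ball of `z`. If `z` has
two non-leaf neighbours, that ball is a common neighbourhood in the cube, so it is a unit ball in
`T₁` too, and counting finds a leaf at its centre (`exists_leaf_of_branching`). If not, `y` is an
end leaf of both roots. Its two parents are twins, as are its two grandparent vertices, unless `v₂`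
is adjacent to the grandparent in `T₁`; exchanging labels corrects `T₁` (`glue_of_center_not_adj`).
The exception is ruled out by the root of the card at a third simplicial vertex
(`false_of_center_adj`). -/

namespace TreeCube

/-! ### Tree metrics: branching, geodesics and leaves -/

/-- `d` is the distance function of a tree with vertex set `A`: a metric such that every vertex
`c` has exactly one neighbour closer to any other given vertex. -/
structure IsTreeMetric {V : Type*} (A : Set V) (d : V → V → ℕ) : Prop where
  self : ∀ x ∈ A, d x x = 0
  eq_of_zero : ∀ x ∈ A, ∀ y ∈ A, d x y = 0 → x = y
  comm : ∀ x ∈ A, ∀ y ∈ A, d x y = d y x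
  tri : ∀ x ∈ A, ∀ y ∈ A, ∀ z ∈ A, d x z ≤ d x y + d y z
  step : ∀ c ∈ A, ∀ u ∈ A, c ≠ u → ∃ a ∈ A, d c a = 1 ∧ d a u + 1 = d c u ∧
    ∀ b ∈ A, d c b = 1 → b ≠ a → d b u = d c u + 1

namespace IsTreeMetric

variable {V : Type*} {A : Set V} {d : V → V → ℕ}

theorem nbr_cases (h : IsTreeMetric A d) {c u b : V} (hc : c ∈ A) (hu : u ∈ A) (hb : b ∈ A)
    (hcb : d c b = 1) : d b u = d c u + 1 ∨ d b u + 1 = d c u := by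
  by_cases hcu : c = u
  · subst hcu
    left
    rw [h.self c hc, h.comm b hb c hc, hcb]
  · obtain ⟨a, ha, h1, h2, h3⟩ := h.step c hc u hu hcu
    by_cases hba : b = a
    · subst hba; exact Or.inr h2
    · exact Or.inl (h3 b hb hcb hba)

theorem nbr_unique (h : IsTreeMetric A d) {c u a b : V} (hc : c ∈ A) (hu : u ∈ A) (ha : a ∈ A)
    (hb : b ∈ A) (hca : d c a = 1) (hcb : d c b = 1) (hau : d a u + 1 = d c u)
    (hbu : d b u + 1 = d c u) : a = b := by
  have hcu : c ≠ u := by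
    rintro rfl
    have := h.self c hc
    omega
  obtain ⟨e, he, h1, h2, h3⟩ := h.step c hc u hu hcu
  by_contra hab
  by_cases hae : a = e
  · have := h3 b hb hcb (by rintro rfl; exact hab hae)
    omega
  · have := h3 a ha hca hae
    omega

/-- A geodesic from `c` to `v` that starts by moving away from `u` never turns back: at each vertex
the only neighbour nearer to `u` is the one just left. -/
theorem split (h : IsTreeMetric A d) {u : V} (hu : u ∈ A) : ∀ (n : ℕ) {c b v : V}, c ∈ A → b ∈ A →
    v ∈ A → d c v = n → d c b = 1 → d b u = d c u + 1 → d b v + 1 = d c v →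
    d u v = d u c + d c v := by
  intro n
  induction n with
  | zero => intro c b v _ _ _ h0 _ _ h3; omega
  | succ n ih =>
    intro c b v hc hb hv h0 h1 h2 h3
    by_cases hbv : b = v
    · subst hbv
      rw [h.comm u hu b hb, h.comm u hu c hc]; omega
    · obtain ⟨b', hb', g1, g2, -⟩ := h.step b hb v hv hbv
      have hcb' : b' ≠ c := by rintro rfl; omega
      have hbc : d b c = 1 := by rw [h.comm b hb c hc, h1]
      have key : d b' u = d b u + 1 := by
        rcases h.nbr_cases hb hu hb' g1 with g | g
        · exact g
        · exact absurd (h.nbr_unique hb hu hb' hc g1 hbc g (by omega)) hcb'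
      have := ih hb hb' hv (by omega) g1 key g2
      rw [this, h.comm u hu b hb, h.comm u hu c hc]; omega

theorem branch (h : IsTreeMetric A d) {c u v : V} (hc : c ∈ A) (hu : u ∈ A) (hv : v ∈ A) :
    d u v = d u c + d c v ∨
      ∃ a ∈ A, d c a = 1 ∧ d a u + 1 = d c u ∧ d a v + 1 = d c v := by
  by_cases hcv : c = v
  · subst hcv; left; rw [h.self c hc]; omega
  · obtain ⟨a, ha, h1, h2, -⟩ := h.step c hc v hv hcv
    rcases h.nbr_cases hc hu ha h1 with g | g
    · exact Or.inl (h.split hu _ hc ha hv rfl h1 g h2)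
    · exact Or.inr ⟨a, ha, h1, g, h2⟩

theorem geod (h : IsTreeMetric A d) {v : V} (hv : v ∈ A) : ∀ (k : ℕ) {u : V}, u ∈ A →
    k ≤ d u v → ∃ t ∈ A, d u t = k ∧ d t v + k = d u v := by
  intro k
  induction k with
  | zero => intro u hu _; exact ⟨u, hu, h.self u hu, rfl⟩
  | succ k ih =>
    intro u hu hk
    have huv : u ≠ v := by rintro rfl; have := h.self u hu; omega
    obtain ⟨a, ha, h1, h2, -⟩ := h.step u hu v hv huv
    obtain ⟨t, ht, g1, g2⟩ := ih ha (by omega)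
    refine ⟨t, ht, ?_, by omega⟩
    have t1 := h.tri u hu a ha t ht
    have t2 := h.tri u hu t ht v hv
    omega

theorem eq_or_adj (h : IsTreeMetric A d) {x t : V} (hx : x ∈ A) (ht : t ∈ A) (hd : d x t ≤ 1) :
    t = x ∨ d x t = 1 := by
  rcases Nat.lt_or_ge (d x t) 1 with h1 | h1
  · exact Or.inl (h.eq_of_zero x hx t ht (by omega)).symm
  · exact Or.inr (by omega)

theorem pos (h : IsTreeMetric A d) {x t : V} (hx : x ∈ A) (ht : t ∈ A) (hne : x ≠ t) :
    1 ≤ d x t := by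
  rcases Nat.lt_or_ge (d x t) 1 with h1 | h1
  · exact absurd (h.eq_of_zero x hx t ht (by omega)) hne
  · exact h1

theorem leaf_dist (h : IsTreeMetric A d) {v y t : V} (hv : v ∈ A) (hy : y ∈ A) (ht : t ∈ A)
    (hleaf : ∀ s ∈ A, d v s = 1 → s = y) (hne : v ≠ t) : d v t = d y t + 1 := by
  obtain ⟨a, ha, h1, h2, -⟩ := h.step v hv t ht hne
  have := hleaf a ha h1
  subst this
  omega

/-- Deleting a leaf from a tree. -/
theorem delete_leaf (h : IsTreeMetric A d) {v y : V} (hv : v ∈ A) {B : Set V}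
    (hB : ∀ x, x ∈ B ↔ x ∈ A ∧ x ≠ v) (hleaf : ∀ s ∈ A, d v s = 1 → s = y) :
    IsTreeMetric B d where
  self x hx := h.self x ((hB x).1 hx).1
  eq_of_zero x hx y hy := h.eq_of_zero x ((hB x).1 hx).1 y ((hB y).1 hy).1
  comm x hx y hy := h.comm x ((hB x).1 hx).1 y ((hB y).1 hy).1
  tri x hx y hy z hz :=
    h.tri x ((hB x).1 hx).1 y ((hB y).1 hy).1 z ((hB z).1 hz).1
  step c hc u hu hcu := by
    obtain ⟨hcA, hcv⟩ := (hB c).1 hc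
    obtain ⟨huA, huv⟩ := (hB u).1 hu
    obtain ⟨a, ha, h1, h2, h3⟩ := h.step c hcA u huA hcu
    refine ⟨a, (hB a).2 ⟨ha, ?_⟩, h1, h2, fun b hb => h3 b ((hB b).1 hb).1⟩
    rintro rfl
    have hcy := hleaf c hcA (by rw [h.comm a ha c hcA, h1])
    subst hcy
    have := h.leaf_dist ha hcA huA hleaf huv.symm
    omega

/-- Attaching a new leaf `v` to the vertex `y` of a tree. -/
theorem add_leaf [DecidableEq V] (h : IsTreeMetric A d) {v y : V} (hv : v ∉ A) (hy : y ∈ A) :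
    IsTreeMetric (insert v A) (fun s t => if s = v then (if t = v then 0 else d y t + 1)
      else if t = v then d y s + 1 else d s t) := by
  have hne : ∀ x ∈ A, x ≠ v := fun x hx e => hv (e ▸ hx)
  refine ⟨?_, ?_, ?_, ?_, ?_⟩
  · rintro x (rfl | hx)
    · simp
    · simp [hne x hx, h.self x hx]
  · rintro x (rfl | hx) z (rfl | hz) h0
    · rfl
    · simp [hne z hz] at h0
    · simp [hne x hx] at h0
    · simp only [hne x hx, hne z hz, if_false] at h0
      exact h.eq_of_zero x hx z hz h0
  · rintro x (rfl | hx) z (rfl | hz)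
    · rfl
    · simp [hne z hz]
    · simp [hne x hx]
    · simp [hne x hx, hne z hz, h.comm x hx z hz]
  · rintro x (rfl | hx) z (rfl | hz) w (rfl | hw)
    · simp
    · simp
    · simp
    · simpa [hne z hz, hne w hw] using (by have := h.tri y hy z hz w hw; omega)
    · simp
    · simp only [hne x hx, hne w hw, if_true, if_false]
      have := h.tri x hx y hy w hw
      have := h.comm x hx y hy
      omega
    · simp only [hne x hx, hne z hz, if_true, if_false]
      have := h.tri y hy z hz x hx
      have := h.comm x hx z hz
      omega
    · simpa [hne x hx, hne z hz, hne w hw] using h.tri x hx z hz w hw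
  · rintro c (rfl | hc) u (rfl | hu) hcu
    · exact absurd rfl hcu
    · refine ⟨y, Or.inr hy, by simp [hne y hy, h.self y hy], by simp [hne y hy, hne u hu], ?_⟩
      rintro b (rfl | hb) hb1 hby
      · simp at hb1
      · simp only [hne b hb, if_true, if_false] at hb1
        exact absurd (h.eq_of_zero y hy b hb (by omega)).symm hby
    · by_cases hcy : c = y
      · subst hcy
        refine ⟨u, Or.inl rfl, by simp [hne c hc, h.self c hc], by simp [hne c hc, h.self c hc], ?_⟩
        rintro b (rfl | hb) hb1 hby
        · exact absurd rfl hby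
        · simp only [hne b hb, hne c hc, if_true, if_false] at hb1 ⊢
          rw [h.self c hc, hb1]
      · obtain ⟨a, ha, h1, h2, h3⟩ := h.step c hc y hy hcy
        refine ⟨a, Or.inr ha, by simp [hne c hc, hne a ha, h1], ?_, ?_⟩
        · simp only [hne a ha, hne c hc, if_true, if_false]
          rw [h.comm y hy a ha, h.comm y hy c hc]; omega
        · rintro b (rfl | hb) hb1 hby
          · simp only [hne c hc, if_true, if_false] at hb1
            exact absurd (h.eq_of_zero y hy c hc (by omega)).symm hcy
          · simp only [hne b hb, hne c hc, if_true, if_false] at hb1 ⊢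
            have := h3 b hb hb1 hby
            rw [h.comm y hy b hb, h.comm y hy c hc]; omega
    · obtain ⟨a, ha, h1, h2, h3⟩ := h.step c hc u hu hcu
      refine ⟨a, Or.inr ha, by simp [hne c hc, hne a ha, h1],
        by simp [hne c hc, hne a ha, hne u hu, h2], ?_⟩
      rintro b (rfl | hb) hb1 hba
      · simp only [hne c hc, hne u hu, if_true, if_false] at hb1 ⊢
        have := h.eq_of_zero y hy c hc (by omega)
        subst this; rfl
      · simp only [hne b hb, hne c hc, hne u hu, if_false] at hb1 ⊢
        exact h3 b hb hb1 hba

/-- Transport of a tree metric along an injection. -/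
theorem comap {W : Type*} (h : IsTreeMetric A d) {B : Set W} (f : W → V)
    (hf : Set.BijOn f B A) : IsTreeMetric B (fun x y => d (f x) (f y)) where
  self x hx := h.self _ (hf.mapsTo hx)
  eq_of_zero x hx y hy h0 :=
    hf.injOn hx hy (h.eq_of_zero _ (hf.mapsTo hx) _ (hf.mapsTo hy) h0)
  comm x hx y hy := h.comm _ (hf.mapsTo hx) _ (hf.mapsTo hy)
  tri x hx y hy z hz := h.tri _ (hf.mapsTo hx) _ (hf.mapsTo hy) _ (hf.mapsTo hz)
  step c hc u hu hcu := by
    obtain ⟨a, ha, h1, h2, h3⟩ := h.step _ (hf.mapsTo hc) _ (hf.mapsTo hu)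
      (fun e => hcu (hf.injOn hc hu e))
    obtain ⟨a, ha', rfl⟩ := hf.surjOn ha
    exact ⟨a, ha', h1, h2, fun b hb hb1 hba =>
      h3 _ (hf.mapsTo hb) hb1 (fun e => hba (hf.injOn hb ha' e))⟩

/-! ### Simplicial vertices of the cube and end leaves -/

/-- The vertex `v` is simplicial in the cube of the tree. -/
def Simp (A : Set V) (d : V → V → ℕ) (v : V) : Prop :=
  ∀ a ∈ A, ∀ b ∈ A, d v a ≤ 3 → d v b ≤ 3 → d a b ≤ 3

/-- By maximality the 3-ball of `u` lies in the 2-ball of its parent `y`, and every vertex at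
distance two from `y` is reached through the neighbour of `y` towards `w`; two such vertices are
therefore within two of each other. -/
theorem simp_of_farthest (h : IsTreeMetric A d) {w u : V} (hw : w ∈ A) (hu : u ∈ A) (hwu : u ≠ w)
    (hmax : ∀ t ∈ A, d w t ≤ d w u) : Simp A d u := by
  obtain ⟨y, hy, h1, h2, -⟩ := h.step u hu w hw hwu
  have near : ∀ a ∈ A, d u a ≤ 3 → d y a ≤ 2 := by
    intro a ha ha3
    by_cases hau : a = u
    · subst hau; rw [h.comm y hy a hu]; omega
    rcases h.nbr_cases hu ha hy h1 with g | g
    · have e := h.split ha _ hu hy hw rfl h1 g h2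
      have := hmax a ha
      have := h.comm w hw a ha
      have := h.comm w hw u hu
      have := h.pos ha hu hau
      omega
    · omega
  have side : ∀ a ∈ A, d y a = 2 → ∃ g ∈ A, d y g = 1 ∧ d g a + 1 = d y a ∧ d g w + 1 = d y w := by
    intro a ha ha2
    rcases h.branch hy ha hw with g | g
    · have := hmax a ha
      have := h.comm w hw a ha
      have := h.comm w hw u hu
      have := h.comm y hy a ha
      omega
    · exact g
  intro a ha b hb ha3 hb3
  have na := near a ha ha3
  have nb := near b hb hb3
  have t1 := h.tri a ha y hy b hb
  have c1 := h.comm a ha y hy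
  by_contra hcon
  obtain ⟨g, hg, p1, p2, p3⟩ := side a ha (by omega)
  obtain ⟨g', hg', q1, q2, q3⟩ := side b hb (by omega)
  have e := h.nbr_unique hy hw hg hg' p1 q1 p3 q3
  subst e
  have t2 := h.tri a ha g hg b hb
  have c2 := h.comm a ha g hg
  omega

/-- Only one neighbour of `w` is nearer to `t` than `w`; the others are farther by one. -/
theorem dist_le_two_of_common (h : IsTreeMetric A d) {w t b b' : V} (hw : w ∈ A) (ht : t ∈ A)
    (hb : b ∈ A) (hb' : b' ∈ A) (hne : b ≠ b') (h1 : d w b = 1) (h2 : d w b' = 1)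
    (h3 : d b t ≤ 3) (h4 : d b' t ≤ 3) : d w t ≤ 2 := by
  by_contra hcon
  rcases h.nbr_cases hw ht hb h1 with g | g
  · omega
  rcases h.nbr_cases hw ht hb' h2 with g' | g'
  · omega
  exact hne (h.nbr_unique hw ht hb hb' h1 h2 g g')

/-- `y` is a leaf attached to `x`, whose neighbours other than `w` are all leaves, while the tree
continues beyond `w`. -/
structure EndLeaf (A : Set V) (d : V → V → ℕ) (y x w : V) : Prop where
  hy : y ∈ A
  hx : x ∈ A
  hw : w ∈ A
  hyx : d y x = 1
  hxw : d x w = 1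
  hyw : y ≠ w
  leaf : ∀ s ∈ A, d x s = 1 → s ≠ w → ∀ t ∈ A, d s t = 1 → t = x
  far : ∃ t ∈ A, d w t = 2 ∧ d x t = 3

/-- Let `v, y, z, r` start the geodesic to `u`. A neighbour `s ≠ z` of `y` with a further neighbour
`s'` would give two vertices `s'`, `r` within three of `v` but at distance four from each other. -/
theorem endLeaf_of_simp (h : IsTreeMetric A d) {v u : V} (hv : v ∈ A) (hu : u ∈ A)
    (hvu : 4 ≤ d v u) (hs : Simp A d v) : ∃ y z, EndLeaf A d v y z := by
  obtain ⟨y, hy, h1, h2, -⟩ := h.step v hv u hu (by rintro rfl; have := h.self v hv; omega)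
  obtain ⟨z, hz, h3, h4, -⟩ := h.step y hy u hu (by rintro rfl; have := h.self y hy; omega)
  obtain ⟨t, ht, g1, g2⟩ := h.geod hu 2 hz (by omega)
  have hvz : v ≠ z := by rintro rfl; omega
  have yt : d y t = 3 := by
    have := h.tri y hy z hz t ht
    have := h.tri y hy t ht u hu
    omega
  obtain ⟨r, hr, k1, k2⟩ := h.geod hu 1 hz (by omega)
  have yr : d y r = 2 := by
    have := h.tri y hy z hz r hr
    have := h.tri y hy r hr u hu
    omega
  have vr : d v r = 3 := by
    have := h.tri v hv y hy r hr
    have := h.tri v hv r hr u hu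
    omega
  refine ⟨y, z, hv, hy, hz, h1, h3, hvz, ?_, t, ht, g1, yt⟩
  intro s hs' hys hsz s' hs'' hss'
  by_contra hne
  have cys := h.comm y hy s hs'
  have ysr : d s r = d y r + 1 := by
    rcases h.nbr_cases hy hr hs' hys with g | g
    · exact g
    · exact absurd (h.nbr_unique hy hr hs' hz hys h3 g (by omega)) hsz
  have s'r : d s' r = d s r + 1 := by
    rcases h.nbr_cases hs' hr hs'' hss' with g | g
    · exact g
    · exact absurd (h.nbr_unique hs' hr hs'' hy hss' (by omega) g (by omega)) hne
  have := hs s' hs'' r hr (by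
    have := h.tri v hv s hs' s' hs''
    have := h.tri v hv y hy s hs'
    omega) (by omega)
  omega

namespace EndLeaf

variable {y x w : V}

theorem leaf_self (e : EndLeaf A d y x w) (h : IsTreeMetric A d) :
    ∀ s ∈ A, d y s = 1 → s = x :=
  e.leaf y e.hy (by rw [h.comm x e.hx y e.hy, e.hyx]) e.hyw

/-- The ball of radius three around an end leaf. -/
theorem ball (e : EndLeaf A d y x w) (h : IsTreeMetric A d) {q : V} (hq : q ∈ A) :
    d y q ≤ 3 ↔ (d x q = 1 ∧ q ≠ w) ∨ d w q ≤ 1 := by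
  have cxw := h.comm x e.hx w e.hw
  have hxw := e.hxw
  have hyx := e.hyx
  constructor
  · intro h3
    by_cases hqy : y = q
    · subst hqy
      exact Or.inl ⟨by rw [h.comm x e.hx y e.hy, e.hyx], e.hyw⟩
    have hyq := h.leaf_dist e.hy e.hx hq (e.leaf_self h) hqy
    by_cases hxq : x = q
    · subst hxq; right; omega
    obtain ⟨a, ha, h1, h2, -⟩ := h.step x e.hx q hq hxq
    by_cases haw : a = w
    · subst haw; right; omega
    · by_cases haq : a = q
      · subst haq; exact Or.inl ⟨h1, haw⟩
      · have := h.leaf_dist ha e.hx hq (e.leaf a ha h1 haw) haq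
        omega
  · have t1 := h.tri y e.hy x e.hx q hq
    have t2 := h.tri x e.hx w e.hw q hq
    rintro (⟨h1, -⟩ | h1) <;> omega

theorem simp (e : EndLeaf A d y x w) (h : IsTreeMetric A d) : Simp A d y := by
  intro a ha b hb h1 h2
  have hxw := e.hxw
  have t1 := h.tri a ha x e.hx b hb
  have t2 := h.tri a ha w e.hw b hb
  have t3 := h.tri x e.hx w e.hw b hb
  have t4 := h.tri a ha x e.hx w e.hw
  have t5 := h.tri w e.hw x e.hx b hb
  have c3 := h.comm w e.hw x e.hx
  have c1 := h.comm a ha x e.hx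
  have c2 := h.comm a ha w e.hw
  rcases (e.ball h ha).1 h1 with ⟨p, -⟩ | p <;> rcases (e.ball h hb).1 h2 with ⟨q, -⟩ | q <;> omega

/-- The twins of an end leaf in the cube are its siblings. -/
theorem twin (e : EndLeaf A d y x w) (h : IsTreeMetric A d) {q : V} (hq : q ∈ A) :
    (∀ t ∈ A, d q t ≤ 3 ↔ d y t ≤ 3) ↔ d x q = 1 ∧ q ≠ w := by
  have hyx := e.hyx
  constructor
  · intro ht
    have h1 := (ht q hq).1 (by rw [h.self q hq]; omega)
    rcases (e.ball h hq).1 h1 with p | p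
    · exact p
    · obtain ⟨t, htA, g1, g2⟩ := e.far
      have := h.tri q hq w e.hw t htA
      have := h.comm q hq w e.hw
      have hyt : y ≠ t := by
        rintro rfl
        have := h.comm y htA x e.hx
        omega
      have := h.leaf_dist e.hy e.hx htA (e.leaf_self h) hyt
      have := (ht t htA).1 (by omega)
      omega
  · rintro ⟨h1, h2⟩ t ht
    have c1 := h.comm x e.hx q hq
    have c2 := h.comm x e.hx y e.hy
    have t1 := h.tri q hq x e.hx y e.hy
    have t2 := h.tri y e.hy x e.hx q hq
    by_cases hqt : q = t
    · subst hqt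
      have := h.self q hq
      constructor <;> intro _ <;> omega
    by_cases hyt : y = t
    · subst hyt
      have := h.self y e.hy
      constructor <;> intro _ <;> omega
    rw [h.leaf_dist hq e.hx ht (e.leaf q hq h1 h2) hqt,
      h.leaf_dist e.hy e.hx ht (e.leaf_self h) hyt]

theorem not_sibling (e : EndLeaf A d y x w) (h : IsTreeMetric A d) {q : V} (hq : q ∈ A)
    (h1 : d w q ≤ 1) : ¬ (d x q = 1 ∧ q ≠ w) := by
  rintro ⟨h2, h3⟩
  have hxw := e.hxw
  have hqx := e.leaf q hq h2 h3 w e.hw (by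
    rcases h.eq_or_adj e.hw hq h1 with g | g
    · exact absurd g h3
    · rw [h.comm q hq w e.hw, g])
  have := h.self x e.hx
  rw [← hqx] at hxw
  have := h.self w e.hw
  omega

theorem ball_x (e : EndLeaf A d y x w) (h : IsTreeMetric A d) {t : V} (ht : t ∈ A) :
    d x t ≤ 3 ↔ d w t ≤ 2 := by
  have hxw := e.hxw
  have cxw := h.comm x e.hx w e.hw
  constructor
  · intro h3
    by_cases hxt : x = t
    · subst hxt; omega
    obtain ⟨a, ha, h1, h2, -⟩ := h.step x e.hx t ht hxt
    by_cases haw : a = w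
    · subst haw; omega
    · by_cases hat : a = t
      · subst hat
        have := h.tri w e.hw x e.hx a ha
        omega
      · have := h.leaf_dist ha e.hx ht (e.leaf a ha h1 haw) hat
        omega
  · have := h.tri x e.hx w e.hw t ht
    omega

/-- The 2-ball of `w` is expressed by its unit ball and adjacency in the cube alone, so it can be
compared between two roots. The converse uses two distinct neighbours of `w`: `x` and one towards
the far vertex. -/
theorem ball_two (e : EndLeaf A d y x w) (h : IsTreeMetric A d) {t : V} (ht : t ∈ A) :
    d w t ≤ 2 ↔ ∀ b ∈ A, d w b ≤ 1 → d b t ≤ 3 := by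
  constructor
  · intro h1 b hb h2
    have := h.tri b hb w e.hw t ht
    have := h.comm b hb w e.hw
    omega
  · intro hall
    obtain ⟨r, hr, g1, g2⟩ := e.far
    obtain ⟨s, hs, k1, k2⟩ := h.geod hr 1 e.hw (by omega)
    have hxw := e.hxw
    have cxw := h.comm x e.hx w e.hw
    have hsx : s ≠ x := by rintro rfl; omega
    exact h.dist_le_two_of_common e.hw ht hs e.hx hsx k1 (by omega) (hall s hs (by omega))
      (hall x e.hx (by omega))

end EndLeaf

/-! ### Common neighbourhoods of distant vertices -/

/-- The edge `ef` lies on the geodesic with `d p f = 3` and `d q e ≥ 3`. A vertex on the side of `e`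
is reached from `q` through `e`, one on the side of `f` from `p` through `f`, which leaves no slack
beyond `e` and `f`. -/
theorem common_of_five (h : IsTreeMetric A d) {p q : V} (hp : p ∈ A) (hq : q ∈ A)
    (h5 : 5 ≤ d p q) : ∃ e ∈ A, ∃ f ∈ A, d p e = 2 ∧ d e f = 1 ∧ d e q + 2 = d p q ∧
      d f q + 3 = d p q ∧ ∀ t ∈ A, d p t ≤ 3 → d q t ≤ 3 → t = e ∨ t = f := by
  obtain ⟨e, he, h1, h2⟩ := h.geod hq 2 hp (by omega)
  obtain ⟨f, hf, h3, h4⟩ := h.geod hq 1 he (by omega)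
  have cpe := h.comm p hp e he
  have hfp : d f p = d e p + 1 := by
    have := h.tri p hp f hf q hq
    have := h.comm p hp f hf
    have := h.nbr_cases he hp hf h3
    omega
  refine ⟨e, he, f, hf, h1, h3, h2, by omega, fun t ht t1 t2 => ?_⟩
  rcases h.nbr_cases he ht hf h3 with g | g
  · left
    have := h.split ht _ he hf hq rfl h3 g h4
    have := h.comm q hq t ht
    exact h.eq_of_zero t ht e he (by omega)
  · right
    have := h.split hp _ he hf ht rfl h3 hfp g
    exact (h.eq_of_zero f hf t ht (by omega)).symm

/-- The midpoint `x` lies between `t` and at least one of `p`, `q`, because these sit in different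
branches at `x`. -/
theorem common_of_four (h : IsTreeMetric A d) {p q : V} (hp : p ∈ A) (hq : q ∈ A)
    (h4 : d p q = 4) : ∃ x ∈ A, ∀ t ∈ A, (d p t ≤ 3 ∧ d q t ≤ 3) ↔ d x t ≤ 1 := by
  obtain ⟨x, hx, h1, h2⟩ := h.geod hq 2 hp (by omega)
  refine ⟨x, hx, fun t ht => ⟨fun ⟨t1, t2⟩ => ?_, fun t1 => ?_⟩⟩
  · have cpx := h.comm p hp x hx
    have cqx := h.comm q hq x hx
    have cqt := h.comm q hq t ht
    rcases h.branch hx hp ht with g | ⟨a, ha, g1, g2, g3⟩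
    · omega
    rcases h.branch hx hq ht with g | ⟨b, hb, k1, k2, k3⟩
    · omega
    have := h.nbr_unique hx ht ha hb g1 k1 g3 k3
    subst this
    have := h.tri p hp a ha q hq
    have := h.comm p hp a ha
    omega
  · have := h.tri p hp x hx t ht
    have := h.tri q hq x hx t ht
    have := h.comm q hq x hx
    omega

/-- Let `qᵢ` be the vertex two steps from `vᵢ` towards the other end. Of two distinct vertices near
`v₂`, at least one lies beyond `q₂` as seen from `y₁`, so `y₁` is within three of `q₂`; likewise
`y₂` of `q₁`. By `common_of_five`, `y₁` is `q₁` or the next vertex of the geodesic, and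
symmetrically for `y₂`. -/
theorem adj_of_two_common (h : IsTreeMetric A d) {v₁ v₂ y₁ y₂ a a' b b' : V}
    (hv₁ : v₁ ∈ A) (hv₂ : v₂ ∈ A) (hy₁ : y₁ ∈ A) (hy₂ : y₂ ∈ A) (ha : a ∈ A) (ha' : a' ∈ A)
    (hb : b ∈ A) (hb' : b' ∈ A) (hfar : 7 ≤ d v₁ v₂) (h1 : d v₁ y₁ ≤ 3) (h2 : d v₂ y₂ ≤ 3)
    (hva : d v₁ a ≤ 3) (hva' : d v₁ a' ≤ 3) (hvb : d v₂ b ≤ 3) (hvb' : d v₂ b' ≤ 3)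
    (haa : a ≠ a') (hbb : b ≠ b') (hyb : d y₁ b ≤ 3) (hyb' : d y₁ b' ≤ 3) (hya : d y₂ a ≤ 3)
    (hya' : d y₂ a' ≤ 3) : d y₁ y₂ ≤ 3 := by
  have key : ∀ {v₁ v₂ y₁ b b' : V}, v₁ ∈ A → v₂ ∈ A → y₁ ∈ A → b ∈ A → b' ∈ A → 7 ≤ d v₁ v₂ →
      d v₁ y₁ ≤ 3 → d v₂ b ≤ 3 → d v₂ b' ≤ 3 → b ≠ b' → d y₁ b ≤ 3 → d y₁ b' ≤ 3 →
      ∃ q ∈ A, d v₂ q = 2 ∧ d q v₁ + 2 = d v₁ v₂ ∧ d y₁ q ≤ 3 := by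
    intro v₁ v₂ y₁ b b' hv₁ hv₂ hy₁ hb hb' hfar h1 hvb hvb' hbb hyb hyb'
    have c0 := h.comm v₁ hv₁ v₂ hv₂
    obtain ⟨q, hq, q1, q2⟩ := h.geod hv₁ 2 hv₂ (by omega)
    obtain ⟨r, hr, r1, r2⟩ := h.geod hv₁ 1 hq (by omega)
    refine ⟨q, hq, q1, by omega, ?_⟩
    have rv₂ : d r v₂ = d q v₂ + 1 := by
      have := h.tri v₂ hv₂ r hr v₁ hv₁
      have := h.comm v₂ hv₂ r hr
      have := h.comm v₂ hv₂ q hq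
      have := h.nbr_cases hq hv₂ hr r1
      omega
    -- Since `r` is already at distance three from `v₂`, it is the only vertex of that 3-ball on its
    -- side of the edge `qr`.
    have hfarside : ∀ b ∈ A, d v₂ b ≤ 3 → d r b + 1 = d q b → b = r := by
      intro b hb hvb hrb
      have := h.split hv₂ _ hq hr hb rfl r1 rv₂ hrb
      exact (h.eq_of_zero r hr b hb (by omega)).symm
    have hy : d r y₁ + 1 = d q y₁ := by
      rcases h.nbr_cases hq hy₁ hr r1 with g | g
      · have := h.split hy₁ _ hq hr hv₁ rfl r1 g r2
        have := h.comm v₁ hv₁ y₁ hy₁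
        omega
      · exact g
    have fin : ∀ b ∈ A, d v₂ b ≤ 3 → d y₁ b ≤ 3 → b ≠ r → d y₁ q ≤ 3 := by
      intro b hb hvb hyb hbr
      rcases h.nbr_cases hq hb hr r1 with g | g
      · have := h.split hb _ hq hr hy₁ rfl r1 g hy
        have := h.comm y₁ hy₁ b hb
        have := h.comm y₁ hy₁ q hq
        omega
      · exact absurd (hfarside b hb hvb g) hbr
    by_cases hbr : b = r
    · exact fin b' hb' hvb' hyb' (fun e => hbb (hbr.trans e.symm))
    · exact fin b hb hvb hyb hbr
  have c0 := h.comm v₁ hv₁ v₂ hv₂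
  obtain ⟨q₂, hq₂, p1, p2, p3⟩ := key hv₁ hv₂ hy₁ hb hb' hfar h1 hvb hvb' hbb hyb hyb'
  obtain ⟨q₁, hq₁, s1, s2, s3⟩ := key hv₂ hv₁ hy₂ ha ha' (by omega) h2 hva hva' haa hya hya'
  have c1 := h.comm v₁ hv₁ q₂ hq₂
  have c2 := h.comm v₂ hv₂ q₁ hq₁
  have c3 := h.comm y₁ hy₁ q₂ hq₂
  have c4 := h.comm y₂ hy₂ q₁ hq₁
  have c5 := h.comm q₁ hq₁ q₂ hq₂
  have c6 := h.comm y₁ hy₁ y₂ hy₂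
  obtain ⟨e, he, f, hf, e1, e2, e3, e4, e5⟩ := h.common_of_five hv₁ hq₂ (by omega)
  obtain ⟨e', he', f', hf', e1', e2', e3', e4', e5'⟩ := h.common_of_five hv₂ hq₁ (by omega)
  have t1 := h.tri v₁ hv₁ e he v₂ hv₂
  have t2 := h.tri v₁ hv₁ q₁ hq₁ e he
  have t3 := h.tri e he q₂ hq₂ v₂ hv₂
  have c7 := h.comm q₂ hq₂ v₂ hv₂
  have c8 := h.comm q₁ hq₁ v₁ hv₁
  -- a point at distance two from `v₁` on the way to `q₂` is `q₁`
  have uniq : ∀ {v₁ v₂ q e : V}, v₁ ∈ A → v₂ ∈ A → q ∈ A → e ∈ A → d v₁ q = 2 → d v₁ e = 2 →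
      d q v₂ + 2 = d v₁ v₂ → d e v₂ + 2 = d v₁ v₂ → 3 ≤ d v₁ v₂ → q = e := by
    intro v₁ v₂ q e hv₁ hv₂ hq he a1 a2 a3 a4 a5
    rcases h.branch hq he hv₂ with g | ⟨b, hb, g1, g2, g3⟩
    · exact (h.eq_of_zero e he q hq (by omega)).symm
    · have hbv : d b v₁ = d q v₁ + 1 := by
        have := h.tri v₁ hv₁ b hb v₂ hv₂
        have := h.comm v₁ hv₁ b hb
        have := h.comm v₁ hv₁ q hq
        have := h.nbr_cases hq hv₁ hb g1
        omega
      have := h.split hv₁ _ hq hb he rfl g1 hbv g2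
      exact h.eq_of_zero q hq e he (by omega)
  have E1 : q₁ = e := uniq hv₁ hv₂ hq₁ he s1 e1 (by omega) (by omega) (by omega)
  have E2 : q₂ = e' := by
    have t1' := h.tri v₂ hv₂ e' he' v₁ hv₁
    have t3' := h.tri e' he' q₁ hq₁ v₁ hv₁
    exact uniq hv₂ hv₁ hq₂ he' p1 e1' (by omega) (by omega) (by omega)
  subst E1 E2
  rcases e5 y₁ hy₁ h1 (by omega) with rfl | rfl
  · omega
  rcases e5' y₂ hy₂ h2 (by omega) with rfl | rfl
  · omega
  have := h.tri y₁ hf q₂ hq₂ y₂ hf'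
  have t4 := h.tri y₁ hf q₂ hq₂ v₂ hv₂
  by_cases hD : d v₁ v₂ = 7
  · -- `q₁, y₁, y₂, q₂` is a path
    have : d q₁ q₂ = 3 := by omega
    omega
  · by_contra hcon
    -- `y₂` lies between `y₁` and `q₂`
    rcases h.nbr_cases hq₂ hf hf' e2' with g | g
    · have t5 := h.split hf _ hq₂ hf' hq₁ rfl e2' g (by omega)
      have := h.comm y₁ hf q₁ hq₁
      omega
    · have := h.comm y₁ hf y₂ hf'
      omega

end IsTreeMetric

end TreeCube

/-! ### Two trees with the same cube -/

namespace TreeCube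

namespace IsTreeMetric

variable {V : Type*} {A : Set V} {d d₁ d₂ : V → V → ℕ}

theorem dist_two (h : IsTreeMetric A d) {z a a' : V} (hz : z ∈ A) (ha : a ∈ A) (ha' : a' ∈ A)
    (h1 : d z a = 1) (h2 : d a a' = 1) (hne : a' ≠ z) : d z a' = 2 := by
  have := h.comm z hz a ha
  have := h.comm z hz a' ha'
  have := h.pos ha' hz hne
  have := h.nbr_cases ha hz ha' h2
  omega

theorem dist_four (h : IsTreeMetric A d) {z a a' b b' : V} (hz : z ∈ A) (ha : a ∈ A) (ha' : a' ∈ A)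
    (hb : b ∈ A) (hb' : b' ∈ A) (hza : d z a = 1) (haa : d a a' = 1) (ha'z : a' ≠ z)
    (hzb : d z b = 1) (hbb : d b b' = 1) (hb'z : b' ≠ z) (hab : a ≠ b) : d a' b' = 4 := by
  have e1 := h.dist_two hz ha ha' hza haa ha'z
  have e2 := h.dist_two hz hb hb' hzb hbb hb'z
  have c := h.comm a' ha' z hz
  have side : d b a' = d z a' + 1 := by
    rcases h.nbr_cases hz ha' hb hzb with g | g
    · exact g
    · exact absurd (h.nbr_unique hz ha' ha hb hza hzb (by omega) g) hab
  have := h.split ha' _ hz hb hb' rfl hzb side (by omega)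
  omega

theorem ball_unique (h : IsTreeMetric A d) {x z a b : V} (hx : x ∈ A) (hz : z ∈ A) (ha : a ∈ A)
    (hb : b ∈ A) (hza : d z a = 1) (hzb : d z b = 1) (hab : a ≠ b) (h1 : d x z ≤ 1)
    (h2 : d x a ≤ 1) (h3 : d x b ≤ 1) : x = z := by
  by_contra hne
  have h4 := h.pos hx hz hne
  have c1 := h.comm x hx z hz
  have c2 := h.comm x hx a ha
  have c3 := h.comm x hx b hb
  refine hab (h.nbr_unique hz hx ha hb hza hzb ?_ ?_)
  · have := h.nbr_cases hz hx ha hza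
    omega
  · have := h.nbr_cases hz hx hb hzb
    omega

/-- If two trees have the same cube, the ball around a vertex with a leaf and two non-leaves as
neighbours in one tree is the ball around a vertex with a leaf in the other. -/
theorem exists_leaf_of_branching [Finite V] (h₁ : IsTreeMetric A d₁) (h₂ : IsTreeMetric A d₂)
    (hh : ∀ a ∈ A, ∀ b ∈ A, d₁ a b ≤ 3 ↔ d₂ a b ≤ 3) {z y a a' b b' : V}
    (hz : z ∈ A) (hy : y ∈ A) (ha : a ∈ A) (ha' : a' ∈ A) (hb : b ∈ A) (hb' : b' ∈ A)
    (hzy : d₂ z y = 1) (hleaf : ∀ s ∈ A, d₂ y s = 1 → s = z)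
    (hza : d₂ z a = 1) (haa : d₂ a a' = 1) (ha'z : a' ≠ z)
    (hzb : d₂ z b = 1) (hbb : d₂ b b' = 1) (hb'z : b' ≠ z) (hab : a ≠ b) :
    ∃ x ∈ A, ∃ l ∈ A, d₁ x l = 1 ∧ (∀ s ∈ A, d₁ l s = 1 → s = x) ∧
      ∀ t ∈ A, d₁ x t ≤ 1 ↔ d₂ z t ≤ 1 := by
  have four := h₂.dist_four hz ha ha' hb hb' hza haa ha'z hzb hbb hb'z hab
  have za' := h₂.dist_two hz ha ha' hza haa ha'z
  have zb' := h₂.dist_two hz hb hb' hzb hbb hb'z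
  have hzz := h₂.self z hz
  have ball₂ : ∀ t ∈ A, (d₂ a' t ≤ 3 ∧ d₂ b' t ≤ 3) ↔ d₂ z t ≤ 1 := by
    obtain ⟨x, hx, hxt⟩ := h₂.common_of_four ha' hb' four
    have mem : ∀ t ∈ A, d₂ z t ≤ 1 → d₂ x t ≤ 1 := by
      intro t ht h1
      refine (hxt t ht).1 ?_
      have := h₂.tri a' ha' z hz t ht
      have := h₂.tri b' hb' z hz t ht
      have := h₂.comm z hz a' ha'
      have := h₂.comm z hz b' hb'
      omega
    have := h₂.ball_unique hx hz ha hb hza hzb hab (mem z hz (by omega)) (mem a ha (by omega))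
      (mem b hb (by omega))
    subst this
    exact hxt
  have common : ∀ t ∈ A, (d₁ a' t ≤ 3 ∧ d₁ b' t ≤ 3) ↔ d₂ z t ≤ 1 := by
    intro t ht
    rw [hh a' ha' t ht, hh b' hb' t ht]
    exact ball₂ t ht
  -- At distance five or more there would be at most two common vertices, but `z`, `a`, `b` are
  -- three.
  have four₁ : d₁ a' b' = 4 := by
    have ge : ¬ d₁ a' b' ≤ 3 := by rw [hh a' ha' b' hb']; omega
    by_contra hne
    obtain ⟨e, -, f, -, -, -, -, -, hef⟩ := h₁.common_of_five ha' hb' (by omega)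
    have mem : ∀ t ∈ A, d₂ z t ≤ 1 → t = e ∨ t = f := fun t ht h1 =>
      hef t ht ((common t ht).2 h1).1 ((common t ht).2 h1).2
    have hza' : z ≠ a := by rintro rfl; omega
    have hzb' : z ≠ b := by rintro rfl; omega
    have m1 := mem z hz (by omega)
    have m2 := mem a ha (by omega)
    have m3 := mem b hb (by omega)
    grind
  obtain ⟨x, hx, hxt⟩ := h₁.common_of_four ha' hb' four₁
  have hball : ∀ t ∈ A, d₁ x t ≤ 1 ↔ d₂ z t ≤ 1 := fun t ht => (hxt t ht).symm.trans (common t ht)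
  have hxx := h₁.self x hx
  -- If no neighbour of `x` is a leaf, each neighbour `p` has a further neighbour `c p`, which in
  -- the second tree hangs on some neighbour `g p ≠ y` of `z`. Distinct `c p` are at distance four
  -- in the first tree, so `g` is injective; but the unit balls agree, so `z` has one neighbour too
  -- few once `y` is excluded.
  by_contra hcon
  have hch : ∀ p, p ∈ A ∧ d₁ x p = 1 → ∃ s, s ∈ A ∧ d₁ p s = 1 ∧ s ≠ x := by
    rintro p ⟨hp, hxp⟩
    by_contra hno
    refine hcon ⟨x, hx, p, hp, hxp, fun s hs hps => ?_, hball⟩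
    by_contra hsx
    exact hno ⟨s, hs, hps, hsx⟩
  choose! c hcA hpc hcx using hch
  have hc : ∀ p, p ∈ A ∧ d₁ x p = 1 → ∃ g, (g ∈ A ∧ d₂ z g = 1 ∧ g ≠ y) ∧ d₂ g (c p) = 1 := by
    intro p hp
    have hcp := hcA p hp
    have x2 := h₁.dist_two hx hp.1 hcp hp.2 (hpc p hp) (hcx p hp)
    have z2 : ¬ d₂ z (c p) ≤ 1 := by rw [← hball _ hcp]; omega
    have adj : ∀ k ∈ A, d₂ z k ≤ 1 → d₂ k (c p) ≤ 3 := by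
      intro k hk h1
      rw [← hh k hk _ hcp]
      have := (hball k hk).2 h1
      have := h₁.tri k hk x hx _ hcp
      have := h₁.comm k hk x hx
      omega
    have z2' := h₂.dist_le_two_of_common hz hcp ha hb hab hza hzb (adj a ha (by omega))
      (adj b hb (by omega))
    obtain ⟨g, hg, g1, g2⟩ := h₂.geod hcp 1 hz (by omega)
    refine ⟨g, ⟨hg, g1, ?_⟩, by omega⟩
    rintro rfl
    have := hleaf _ hcp (by omega)
    rw [this] at z2
    omega
  choose! g hg hgc using hc
  have hinj : Set.InjOn g {p | p ∈ A ∧ d₁ x p = 1} := by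
    intro p hp q hq hpq
    by_contra hne
    have f1 := h₁.dist_four hx hp.1 (hcA p hp) hq.1 (hcA q hq) hp.2 (hpc p hp) (hcx p hp) hq.2
      (hpc q hq) (hcx q hq) hne
    have f2 : ¬ d₂ (c p) (c q) ≤ 3 := by rw [← hh _ (hcA p hp) _ (hcA q hq)]; omega
    have := h₂.tri _ (hcA p hp) _ (hg p hp).1 _ (hcA q hq)
    have := h₂.comm _ (hcA p hp) _ (hg p hp).1
    have e1 := hgc p hp
    have e2 := hgc q hq
    rw [← hpq] at e2
    omega
  have hle : {p | p ∈ A ∧ d₁ x p = 1}.ncard ≤ {q | q ∈ A ∧ d₂ z q = 1 ∧ q ≠ y}.ncard :=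
    Set.ncard_le_ncard_of_injOn g (fun p hp => hg p hp) hinj (Set.toFinite _)
  have k1 : {t | t ∈ A ∧ d₁ x t ≤ 1} = insert x {p | p ∈ A ∧ d₁ x p = 1} := by
    ext t
    constructor
    · rintro ⟨ht, h1⟩
      rcases h₁.eq_or_adj hx ht h1 with rfl | h1
      · exact Or.inl rfl
      · exact Or.inr ⟨ht, h1⟩
    · rintro (rfl | ⟨ht, h1⟩)
      · exact ⟨hx, by omega⟩
      · exact ⟨ht, by omega⟩
  have k2 : {t | t ∈ A ∧ d₁ x t ≤ 1} = insert z (insert y {q | q ∈ A ∧ d₂ z q = 1 ∧ q ≠ y}) := by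
    ext t
    constructor
    · rintro ⟨ht, h1⟩
      rcases h₂.eq_or_adj hz ht ((hball t ht).1 h1) with rfl | h1
      · exact Or.inl rfl
      · by_cases hty : t = y
        · exact Or.inr (Or.inl hty)
        · exact Or.inr (Or.inr ⟨ht, h1, hty⟩)
    · rintro (rfl | rfl | ⟨ht, h1, -⟩)
      · exact ⟨hz, (hball _ hz).2 (by omega)⟩
      · exact ⟨hy, (hball _ hy).2 (by omega)⟩
      · exact ⟨ht, (hball _ ht).2 (by omega)⟩
  have n1 := congrArg Set.ncard k1
  have n2 := congrArg Set.ncard k2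
  rw [Set.ncard_insert_of_notMem (by rintro ⟨-, h1⟩; omega) (Set.toFinite _)] at n1
  rw [Set.ncard_insert_of_notMem (by
      rintro (rfl | ⟨-, h1, -⟩) <;> omega) (Set.toFinite _),
    Set.ncard_insert_of_notMem (by rintro ⟨-, -, h1⟩; exact h1 rfl) (Set.toFinite _)] at n2
  omega

section TwoRoots

variable {y x w z m : V}

theorem sibling_iff (h₁ : IsTreeMetric A d₁) (h₂ : IsTreeMetric A d₂)
    (hh : ∀ a ∈ A, ∀ b ∈ A, d₁ a b ≤ 3 ↔ d₂ a b ≤ 3) (e₁ : EndLeaf A d₁ y x w)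
    (e₂ : EndLeaf A d₂ y z m) {q : V} (hq : q ∈ A) :
    (d₁ x q = 1 ∧ q ≠ w) ↔ (d₂ z q = 1 ∧ q ≠ m) := by
  rw [← e₁.twin h₁ hq, ← e₂.twin h₂ hq]
  refine forall₂_congr fun t ht => ?_
  rw [hh q hq t ht, hh y e₁.hy t ht]

/-- The 3-ball of `y` is the disjoint union of its siblings, which are its twins, and the unit ball
of the centre. -/
theorem center_ball_iff (h₁ : IsTreeMetric A d₁) (h₂ : IsTreeMetric A d₂)
    (hh : ∀ a ∈ A, ∀ b ∈ A, d₁ a b ≤ 3 ↔ d₂ a b ≤ 3) (e₁ : EndLeaf A d₁ y x w)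
    (e₂ : EndLeaf A d₂ y z m) {q : V} (hq : q ∈ A) : d₁ w q ≤ 1 ↔ d₂ m q ≤ 1 := by
  have s := sibling_iff h₁ h₂ hh e₁ e₂ hq
  have b1 := e₁.ball h₁ hq
  have b2 := e₂.ball h₂ hq
  have n1 := e₁.not_sibling h₁ hq
  have n2 := e₂.not_sibling h₂ hq
  have := hh y e₁.hy q hq
  tauto

theorem center_two_iff (h₁ : IsTreeMetric A d₁) (h₂ : IsTreeMetric A d₂)
    (hh : ∀ a ∈ A, ∀ b ∈ A, d₁ a b ≤ 3 ↔ d₂ a b ≤ 3) (e₁ : EndLeaf A d₁ y x w)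
    (e₂ : EndLeaf A d₂ y z m) {t : V} (ht : t ∈ A) : d₁ w t ≤ 2 ↔ d₂ m t ≤ 2 := by
  rw [e₁.ball_two h₁ ht, e₂.ball_two h₂ ht]
  refine forall₂_congr fun b hb => ?_
  rw [center_ball_iff h₁ h₂ hh e₁ e₂ hb, hh b hb t ht]

/-- Otherwise the geodesic from `m` to `t` leaves through some `b ≠ w`. Then `m` and `b` are two
`d₁`-neighbours of `w` within three of the vertex `s` on it with `d₂ m s = 3`, which forces `s` into
the common 2-ball of `w` and `m`. -/
theorem center_side (h₁ : IsTreeMetric A d₁) (h₂ : IsTreeMetric A d₂)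
    (hh : ∀ a ∈ A, ∀ b ∈ A, d₁ a b ≤ 3 ↔ d₂ a b ≤ 3) (e₁ : EndLeaf A d₁ y x w)
    (e₂ : EndLeaf A d₂ y z m) (hwm : w ≠ m) {t : V} (ht : t ∈ A) (h3 : 3 ≤ d₂ m t) :
    d₂ w t + 1 = d₂ m t := by
  have hw := e₁.hw
  have hm := e₂.hw
  have hww := h₁.self w hw
  have hmm := h₂.self m hm
  have mw : d₂ m w = 1 := by
    have := h₂.pos hm hw hwm.symm
    have := (center_ball_iff h₁ h₂ hh e₁ e₂ hw).1 (by omega)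
    omega
  have wm : d₁ w m = 1 := by
    have := h₁.pos hw hm hwm
    have := (center_ball_iff h₁ h₂ hh e₁ e₂ hm).2 (by omega)
    omega
  obtain ⟨b, hb, g1, g2⟩ := h₂.geod ht 1 hm (by omega)
  obtain ⟨s, hs, k1, k2⟩ := h₂.geod ht 2 hb (by omega)
  by_cases hbw : b = w
  · subst hbw; exact g2
  have hbm : b ≠ m := by rintro rfl; omega
  have wb : d₁ w b = 1 := by
    have := h₁.pos hw hb (Ne.symm hbw)
    have := (center_ball_iff h₁ h₂ hh e₁ e₂ hb).2 (by omega)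
    omega
  have t1 := h₂.tri m hm b hb s hs
  have t2 := h₂.tri m hm s hs t ht
  have := h₁.dist_le_two_of_common hw hs hb hm hbm wb wm ((hh b hb s hs).2 (by omega))
    ((hh m hm s hs).2 (by omega))
  have := (center_two_iff h₁ h₂ hh e₁ e₂ hs).1 this
  omega

/-- For `t` with `d₁ w t = 4`, `center_side` in one direction gives `d₁ m t = 3`, hence `d₂ m t =
3`; in the other it gives `d₂ w t = 2`, so `w` and `t` are adjacent in the cube. -/
theorem center_univ (h₁ : IsTreeMetric A d₁) (h₂ : IsTreeMetric A d₂)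
    (hh : ∀ a ∈ A, ∀ b ∈ A, d₁ a b ≤ 3 ↔ d₂ a b ≤ 3) (e₁ : EndLeaf A d₁ y x w)
    (e₂ : EndLeaf A d₂ y z m) (hwm : w ≠ m) {u : V} (hu : u ∈ A) : d₁ w u ≤ 3 := by
  have hw := e₁.hw
  have hm := e₂.hw
  by_contra hcon
  obtain ⟨t, ht, g1, g2⟩ := h₁.geod hu 4 hw (by omega)
  have s1 := center_side h₂ h₁ (fun a ha b hb => (hh a ha b hb).symm) e₂ e₁ hwm.symm ht (by omega)
  have := (hh m hm t ht).1 (by omega)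
  have := center_two_iff h₁ h₂ hh e₁ e₂ ht
  have s2 := center_side h₁ h₂ hh e₁ e₂ hwm ht (by omega)
  have := (hh w hw t ht).2 (by omega)
  omega

/-- The 3-ball of either parent is the 2-ball of its centre, and these agree. -/
theorem parent_twin (h₁ : IsTreeMetric A d₁) (h₂ : IsTreeMetric A d₂)
    (hh : ∀ a ∈ A, ∀ b ∈ A, d₁ a b ≤ 3 ↔ d₂ a b ≤ 3) (e₁ : EndLeaf A d₁ y x w)
    (e₂ : EndLeaf A d₂ y z m) {t : V} (ht : t ∈ A) : d₁ x t ≤ 3 ↔ d₁ z t ≤ 3 := by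
  rw [hh z e₂.hx t ht, e₁.ball_x h₁ ht, e₂.ball_x h₂ ht, center_two_iff h₁ h₂ hh e₁ e₂ ht]

end TwoRoots

end IsTreeMetric

end TreeCube

/-! ### Cube roots of induced subgraphs -/

namespace TreeCube

/-- A vertex is simplicial if its neighbourhood is a clique. -/
def IsSimplicial {V : Type*} (H : SimpleGraph V) (v : V) : Prop :=
  ∀ a b, H.Adj v a → H.Adj v b → a ≠ b → H.Adj a b

/-- `d` is the distance function of a tree on `A` whose cube is the subgraph of `H` induced
on `A`. -/
structure IsCubeRoot {V : Type*} (H : SimpleGraph V) (A : Set V) (d : V → V → ℕ) : Prop where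
  metric : IsTreeMetric A d
  adj : ∀ x ∈ A, ∀ y ∈ A, x ≠ y → (H.Adj x y ↔ d x y ≤ 3)

variable {V : Type*} {H : SimpleGraph V} {A : Set V} {d d₁ d₂ : V → V → ℕ}

namespace IsCubeRoot

theorem simp (r : IsCubeRoot H A d) {v : V} (hv : v ∈ A) (hs : IsSimplicial H v) :
    IsTreeMetric.Simp A d v := by
  intro a ha b hb h1 h2
  by_cases hab : a = b
  · subst hab; rw [r.metric.self a ha]; omega
  by_cases hva : v = a
  · subst hva; exact h2
  by_cases hvb : v = b
  · subst hvb; rw [r.metric.comm a ha v hb]; exact h1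
  exact (r.adj a ha b hb hab).1 (hs a b ((r.adj v hv a ha hva).2 h1) ((r.adj v hv b hb hvb).2 h2) hab)

theorem adj_of_simp (r : IsCubeRoot H A d) {v a b : V} (hv : v ∈ A) (ha : a ∈ A) (hb : b ∈ A)
    (hs : IsTreeMetric.Simp A d v) (hva : H.Adj v a) (hvb : H.Adj v b) (hab : a ≠ b) :
    H.Adj a b :=
  (r.adj a ha b hb hab).2 (hs a ha b hb ((r.adj v hv a ha hva.ne).1 hva)
    ((r.adj v hv b hb hvb.ne).1 hvb))

/-- At distance four to six, the vertex three steps along the geodesic would be a common neighbour.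
-/
theorem seven_le (r : IsCubeRoot H A d) {x y : V} (hx : x ∈ A) (hy : y ∈ A) (hne : x ≠ y)
    (hxy : ¬ H.Adj x y) (hc : ∀ w ∈ A, H.Adj x w → ¬ H.Adj y w) : 7 ≤ d x y := by
  rw [r.adj x hx y hy hne] at hxy
  by_contra hlt
  obtain ⟨t, ht, h1, h2⟩ := r.metric.geod hy 3 hx (by omega)
  have c := r.metric.comm t ht y hy
  refine hc t ht ((r.adj x hx t ht ?_).2 (by omega)) ((r.adj y hy t ht ?_).2 (by omega))
  · rintro rfl
    have := r.metric.self x hx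
    omega
  · rintro rfl
    have := r.metric.self y hy
    omega

theorem no_common (r : IsCubeRoot H A d) {x y w : V} (hx : x ∈ A) (hy : y ∈ A) (hw : w ∈ A)
    (h7 : 7 ≤ d x y) (hxw : H.Adj x w) : ¬ H.Adj y w := by
  intro hyw
  have h1 := (r.adj x hx w hw hxw.ne).1 hxw
  have h2 := (r.adj y hy w hw hyw.ne).1 hyw
  have := r.metric.tri x hx w hw y hy
  have := r.metric.comm y hy w hw
  omega

theorem not_adj (r : IsCubeRoot H A d) {x y : V} (hx : x ∈ A) (hy : y ∈ A)
    (h4 : 4 ≤ d x y) : ¬ H.Adj x y := by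
  intro h
  have := (r.adj x hx y hy h.ne).1 h
  omega

theorem four_le (r : IsCubeRoot H A d) {x y : V} (hx : x ∈ A) (hy : y ∈ A) (hne : x ≠ y)
    (h : ¬ H.Adj x y) : 4 ≤ d x y := by
  rw [r.adj x hx y hy hne] at h
  omega

theorem attach {v y : V} (r : IsCubeRoot H {v}ᶜ d) (hy : y ≠ v)
    (hadj : ∀ t, t ≠ v → (H.Adj v t ↔ d y t ≤ 2)) : ∃ d', IsCubeRoot H Set.univ d' := by
  classical
  have hm := r.metric.add_leaf (v := v) (y := y) (by simp) hy
  rw [show insert v ({v}ᶜ : Set V) = Set.univ by ext t; simp [em]] at hm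
  refine ⟨_, hm, ?_⟩
  intro x _ z _ hxz
  by_cases hx : x = v
  · subst hx
    rw [hadj z hxz.symm]
    simp only [hxz.symm, if_true, if_false]
    omega
  · by_cases hz : z = v
    · subst hz
      rw [SimpleGraph.adj_comm, hadj x hx]
      simp only [hx, if_true, if_false]
      omega
    · simp only [hx, hz, if_false]
      exact r.adj x hx z hz hxz

/-- Exchanging two twins is an automorphism of the induced subgraph, so it turns a root into another
root. -/
theorem swap [DecidableEq V] (r : IsCubeRoot H A d) {x z : V} (hx : x ∈ A) (hz : z ∈ A)
    (htwin : ∀ t ∈ A, t ≠ x → t ≠ z → (H.Adj x t ↔ H.Adj z t)) :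
    IsCubeRoot H A (fun a b => d (Equiv.swap x z a) (Equiv.swap x z b)) := by
  have hmem : ∀ a ∈ A, Equiv.swap x z a ∈ A := by
    intro a ha
    rw [Equiv.swap_apply_def]
    split_ifs <;> assumption
  refine ⟨r.metric.comap _ ⟨hmem, (Equiv.swap x z).injective.injOn, fun a ha =>
    ⟨Equiv.swap x z a, hmem a ha, Equiv.swap_apply_self x z a⟩⟩, ?_⟩
  intro a ha b hb hab
  rw [← r.adj _ (hmem a ha) _ (hmem b hb) ((Equiv.swap x z).injective.ne hab)]
  have c1 := fun t => H.adj_comm t x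
  have c2 := fun t => H.adj_comm t z
  simp only [Equiv.swap_apply_def]
  split_ifs <;> subst_vars <;> grind

/-- As a simplicial vertex with a non-neighbour, `s` is a leaf of the root, and `v` can be hung on
its parent. -/
theorem glue_twin {v s : V} (r : IsCubeRoot H {v}ᶜ d) (hsv : s ≠ v) (hs : IsSimplicial H s)
    (hadj : H.Adj v s) (htwin : ∀ t, t ≠ v → t ≠ s → (H.Adj v t ↔ H.Adj s t))
    (hnon : ∃ u, u ≠ v ∧ u ≠ s ∧ ¬ H.Adj s u) : ∃ d', IsCubeRoot H Set.univ d' := by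
  obtain ⟨u, huv, hus, hu⟩ := hnon
  obtain ⟨y, w, e⟩ := r.metric.endLeaf_of_simp hsv huv (r.four_le hsv huv hus.symm hu)
    (r.simp hsv hs)
  have hyx := e.hyx
  have c := r.metric.comm y e.hx s hsv
  refine r.attach e.hx fun t ht => ?_
  by_cases hts : t = s
  · subst hts
    exact iff_of_true hadj (by omega)
  · rw [htwin t ht hts, r.adj s hsv t ht (Ne.symm hts),
      r.metric.leaf_dist hsv e.hx ht (e.leaf_self r.metric) (Ne.symm hts)]
    omega

/-- A simplicial vertex can be deleted from the root. -/
theorem delete (r : IsCubeRoot H A d) {v u : V} (hv : v ∈ A) (hu : u ∈ A) (huv : u ≠ v)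
    (hnon : ¬ H.Adj v u) (hs : IsSimplicial H v) {B : Set V}
    (hB : ∀ x, x ∈ B ↔ x ∈ A ∧ x ≠ v) : IsCubeRoot H B d := by
  obtain ⟨y, w, e⟩ := r.metric.endLeaf_of_simp hv hu (r.four_le hv hu huv.symm hnon)
    (r.simp hv hs)
  exact ⟨r.metric.delete_leaf hv hB (e.leaf_self r.metric),
    fun x hx y hy => r.adj x ((hB x).1 hx).1 y ((hB y).1 hy).1⟩

end IsCubeRoot

/-! ### Gluing the roots of two cards -/

section Glue

variable {v₁ v₂ y x w z m : V}

/-- In the first root `y` hangs on `x` with centre `w`, whereas the neighbourhood of `v₁` asks for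
`z` and `m`. As `v₂` is adjacent to none of the four, `x`, `z` are twins in `H - v₁`, and so are
`w`, `m`; after exchanging both pairs, the 2-ball of `y` is the neighbourhood of `v₁`. -/
theorem glue_of_center_not_adj (r₁ : IsCubeRoot H {v₁}ᶜ d₁)
    (hA : ∀ t, t ∈ A ↔ t ≠ v₁ ∧ t ≠ v₂) (hne : v₁ ≠ v₂)
    (h₁ : IsTreeMetric A d₁) (h₂ : IsTreeMetric A d₂)
    (hh : ∀ a ∈ A, ∀ b ∈ A, d₁ a b ≤ 3 ↔ d₂ a b ≤ 3) (e₁ : IsTreeMetric.EndLeaf A d₁ y x w)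
    (e₂ : IsTreeMetric.EndLeaf A d₂ y z m)
    (hK : ∀ t ∈ A, H.Adj v₁ t ↔ d₂ z t ≤ 1) (hnadj : ¬ H.Adj v₁ v₂)
    (hfar : ∀ t, H.Adj v₁ t → ¬ H.Adj v₂ t) (hbig : ∃ t ∈ A, 3 ≤ d₁ w t)
    (hw : ¬ H.Adj v₂ w) : ∃ d', IsCubeRoot H Set.univ d' := by
  classical
  obtain ⟨t₀, ht₀, hbig⟩ := hbig
  have sub : ∀ {t}, t ∈ A → t ∈ ({v₁}ᶜ : Set V) := fun ht => ((hA _).1 ht).1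
  have hv₂ : v₂ ∈ ({v₁}ᶜ : Set V) := hne.symm
  have ne₂ : ∀ {t}, t ∈ A → t ≠ v₂ := fun ht => ((hA _).1 ht).2
  have yA := e₁.hy
  have xA := e₁.hx
  have wA := e₁.hw
  have zA := e₂.hx
  have mA := e₂.hw
  have yx := e₁.hyx
  have xw := e₁.hxw
  have yz := e₂.hyx
  have zm := e₂.hxw
  have czy := h₂.comm y yA z zA
  have cxy := h₁.comm y yA x xA
  have hzz := h₂.self z zA
  have hxx := h₁.self x xA
  have hww := h₁.self w wA
  have hmm := h₂.self m mA
  have sib : ∀ {q}, q ∈ A → ((d₁ x q = 1 ∧ q ≠ w) ↔ (d₂ z q = 1 ∧ q ≠ m)) :=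
    fun hq => IsTreeMetric.sibling_iff h₁ h₂ hh e₁ e₂ hq
  have tw : ∀ {t}, t ∈ A → (d₁ x t ≤ 3 ↔ d₁ z t ≤ 3) :=
    fun ht => IsTreeMetric.parent_twin h₁ h₂ hh e₁ e₂ ht
  have hxw : x ≠ w := by rintro rfl; omega
  have hzm : z ≠ m := by rintro rfl; omega
  have hyx : y ≠ x := by rintro rfl; omega
  have hyz : y ≠ z := by rintro rfl; omega
  have hyw := e₁.hyw
  have hym := e₂.hyw
  have bx := e₁.ball_x h₁ ht₀
  -- If `z = w`, then `t₀` is within three of `z`, hence of its twin `x`, hence within two of `w`,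
  -- against the choice of `t₀`.
  have hzw : z ≠ w := by
    rintro rfl
    have := IsTreeMetric.center_univ h₁ h₂ hh e₁ e₂ hzm ht₀
    have := tw ht₀
    omega
  have hxm : x ≠ m := by
    rintro rfl
    have := IsTreeMetric.center_univ h₂ h₁ (fun a ha b hb => (hh a ha b hb).symm) e₂ e₁ hxw ht₀
    have := hh x xA t₀ ht₀
    omega
  have nzv : ¬ H.Adj v₂ z := hfar z ((hK z zA).2 (by omega))
  have nmv : ¬ H.Adj v₂ m := hfar m ((hK m mA).2 (by omega))
  have nyv : ¬ H.Adj v₂ y := hfar y ((hK y yA).2 (by omega))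
  have four : ∀ {t}, t ∈ A → ¬ H.Adj v₂ t → 4 ≤ d₁ t v₂ := fun ht h =>
    r₁.four_le (sub ht) hv₂ (ne₂ ht) (fun h' => h h'.symm)
  -- The geodesic from `x` to `v₂` cannot start with `w`, which is too far from `v₂`, nor with a
  -- sibling of `y`, which is a neighbour of `v₁`.
  have nxv : ¬ H.Adj v₂ x := by
    intro h
    have h3 := (r₁.adj x (sub xA) v₂ hv₂ (ne₂ xA)).1 h.symm
    have w4 := four wA hw
    obtain ⟨b, hb, g1, g2, -⟩ := r₁.metric.step x (sub xA) v₂ hv₂ (ne₂ xA)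
    by_cases hbv : b = v₂
    · subst hbv
      have := r₁.metric.tri w (sub wA) x (sub xA) b hb
      have := h₁.comm w wA x xA
      omega
    have bA : b ∈ A := (hA b).2 ⟨hb, hbv⟩
    by_cases hbw : b = w
    · subst hbw; omega
    have := (sib bA).1 ⟨g1, hbw⟩
    have := four bA (hfar b ((hK b bA).2 (by omega)))
    omega
  have tw₁ : ∀ t ∈ ({v₁}ᶜ : Set V), t ≠ x → t ≠ z → (H.Adj x t ↔ H.Adj z t) := by
    intro t ht htx htz
    by_cases htv : t = v₂
    · subst htv
      exact iff_of_false (fun h => nxv h.symm) (fun h => nzv h.symm)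
    · rw [r₁.adj x (sub xA) t ht htx.symm, r₁.adj z (sub zA) t ht htz.symm]
      exact tw ((hA t).2 ⟨ht, htv⟩)
  have tw₂ : ∀ t ∈ ({v₁}ᶜ : Set V), t ≠ w → t ≠ m → (H.Adj w t ↔ H.Adj m t) := by
    intro t ht htw htm
    by_cases hwm : w = m
    · rw [hwm]
    by_cases htv : t = v₂
    · subst htv
      exact iff_of_false (fun h => hw h.symm) (fun h => nmv h.symm)
    · have htA := (hA t).2 ⟨ht, htv⟩
      rw [r₁.adj w (sub wA) t ht htw.symm, r₁.adj m (sub mA) t ht htm.symm]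
      -- Distinct centres are both within three of all of `A`.
      refine iff_of_true (IsTreeMetric.center_univ h₁ h₂ hh e₁ e₂ hwm htA) ?_
      rw [hh m mA t htA]
      exact IsTreeMetric.center_univ h₂ h₁ (fun a ha b hb => (hh a ha b hb).symm) e₂ e₁
        (Ne.symm hwm) htA
  have r := (r₁.swap (sub xA) (sub zA) tw₁).swap (sub wA) (sub mA) tw₂
  refine r.attach (sub yA) fun t ht => ?_
  have fixed : ∀ s, s ≠ x → s ≠ z → s ≠ w → s ≠ m →
      Equiv.swap x z (Equiv.swap w m s) = s := by
    intro s a b c e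
    rw [Equiv.swap_apply_of_ne_of_ne c e, Equiv.swap_apply_of_ne_of_ne a b]
  rw [fixed y hyx hyz hyw hym]
  by_cases htv : t = v₂
  · subst htv
    rw [fixed t (ne₂ xA).symm (ne₂ zA).symm (ne₂ wA).symm (ne₂ mA).symm]
    have := four yA nyv
    exact iff_of_false hnadj (by omega)
  have tA := (hA t).2 ⟨ht, htv⟩
  rw [hK t tA]
  have yb : ∀ {s}, s ∈ A → s ≠ y → d₁ y s = d₁ x s + 1 := fun hs hne =>
    h₁.leaf_dist yA xA hs (e₁.leaf_self h₁) (Ne.symm hne)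
  by_cases htz : t = z
  · subst htz
    rw [Equiv.swap_apply_of_ne_of_ne hzw hzm, Equiv.swap_apply_right]
    exact iff_of_true (by omega) (by omega)
  by_cases htm : t = m
  · subst htm
    rw [Equiv.swap_apply_right, Equiv.swap_apply_of_ne_of_ne hxw.symm hzw.symm]
    have := yb wA hyw.symm
    exact iff_of_true (by omega) (by omega)
  by_cases htw : t = w
  · subst htw
    rw [Equiv.swap_apply_left, Equiv.swap_apply_of_ne_of_ne hxm.symm hzm.symm]
    have n1 := (sib tA).not
    have n2 : d₂ z t ≠ 1 := fun h => (n1.1 (by simp)) ⟨h, htm⟩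
    have n3 := h₂.pos zA tA hzw
    refine iff_of_false (by omega) ?_
    have := yb mA hym.symm
    have n4 := (sib mA).not
    have n5 : d₁ x m ≠ 1 := fun h => (n4.2 (by simp)) ⟨h, Ne.symm htm⟩
    have := h₁.pos xA mA hxm
    omega
  by_cases htx : t = x
  · subst htx
    rw [Equiv.swap_apply_of_ne_of_ne hxw hxm, Equiv.swap_apply_left]
    have n1 : d₂ z t ≠ 1 := fun h => by
      have := ((sib tA).2 ⟨h, hxm⟩).1
      omega
    have n3 := h₂.pos zA tA (Ne.symm htz)
    refine iff_of_false (by omega) ?_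
    have := yb zA hyz.symm
    have n5 : d₁ t z ≠ 1 := fun h => by
      have := ((sib zA).1 ⟨h, hzw⟩).1
      omega
    have := h₁.pos tA zA htz
    omega
  rw [fixed t htx htz htw htm]
  have s := sib tA
  have p1 := h₂.pos zA tA (Ne.symm htz)
  have p2 := h₁.pos xA tA (Ne.symm htx)
  by_cases hty : t = y
  · subst hty
    exact iff_of_true (by omega) (by have := h₁.self t tA; omega)
  have := yb tA hty
  constructor
  · intro h
    have := (s.2 ⟨by omega, htm⟩).1
    omega
  · intro h
    have := (s.1 ⟨by omega, htw⟩).1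
    omega

/-- Here `w ≠ m`, so all of `A` is within three of `w`, and a vertex `u` at distance three is
simplicial in `H`. Let `w, z', y', v₂` be the geodesic in the first root. In a root of `H - u`, `v₁`
and `v₂` are at distance at least seven, `y` is adjacent to `w`, `z'` near `v₂`, and `y'` to `z`,
`m` near `v₁`. Then `adj_of_two_common` makes `y` and `y'` adjacent, although `d₁ y y' = 4`. -/
theorem false_of_center_adj (r₁ : IsCubeRoot H {v₁}ᶜ d₁)
    (hA : ∀ t, t ∈ A ↔ t ≠ v₁ ∧ t ≠ v₂) (hne : v₁ ≠ v₂)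
    (h₁ : IsTreeMetric A d₁) (h₂ : IsTreeMetric A d₂)
    (hh : ∀ a ∈ A, ∀ b ∈ A, d₁ a b ≤ 3 ↔ d₂ a b ≤ 3) (e₁ : IsTreeMetric.EndLeaf A d₁ y x w)
    (e₂ : IsTreeMetric.EndLeaf A d₂ y z m)
    (hK : ∀ t ∈ A, H.Adj v₁ t ↔ d₂ z t ≤ 1) (hnadj : ¬ H.Adj v₁ v₂)
    (hfar : ∀ t, H.Adj v₁ t → ¬ H.Adj v₂ t) (hbig : ∃ t ∈ A, 3 ≤ d₁ w t)
    (hroot : ∀ v, IsSimplicial H v → ∃ d, IsCubeRoot H {v}ᶜ d)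
    (hw : H.Adj v₂ w) : False := by
  obtain ⟨u, uA, hbig⟩ := hbig
  have sub : ∀ {t}, t ∈ A → t ∈ ({v₁}ᶜ : Set V) := fun ht => ((hA _).1 ht).1
  have hv₂ : v₂ ∈ ({v₁}ᶜ : Set V) := hne.symm
  have ne₂ : ∀ {t}, t ∈ A → t ≠ v₂ := fun ht => ((hA _).1 ht).2
  have yA := e₁.hy
  have xA := e₁.hx
  have wA := e₁.hw
  have zA := e₂.hx
  have mA := e₂.hw
  have yx := e₁.hyx
  have xw := e₁.hxw
  have yz := e₂.hyx
  have zm := e₂.hxw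
  have czy := h₂.comm y yA z zA
  have czm := h₂.comm z zA m mA
  have cxy := h₁.comm y yA x xA
  have cxw := h₁.comm x xA w wA
  have hzz := h₂.self z zA
  have hxx := h₁.self x xA
  have hww := h₁.self w wA
  have hmm := h₂.self m mA
  have hzm : z ≠ m := by rintro rfl; omega
  have mK : H.Adj v₁ m := (hK m mA).2 (by omega)
  have zK : H.Adj v₁ z := (hK z zA).2 (by omega)
  have yK : H.Adj v₁ y := (hK y yA).2 (by omega)
  have hwm : w ≠ m := by rintro rfl; exact hfar w mK hw
  have univ : ∀ t ∈ A, d₁ w t ≤ 3 := fun t ht => IsTreeMetric.center_univ h₁ h₂ hh e₁ e₂ hwm ht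
  have wu : d₁ w u = 3 := by have := univ u uA; omega
  have mu := IsTreeMetric.center_side h₂ h₁ (fun a ha b hb => (hh a ha b hb).symm) e₂ e₁ hwm.symm
    uA hbig
  have wz := (IsTreeMetric.center_ball_iff h₁ h₂ hh e₁ e₂ zA).2 (by omega)
  have wm : d₁ w m = 1 := by
    have := (IsTreeMetric.center_ball_iff h₁ h₂ hh e₁ e₂ mA).2 (by omega)
    have := h₁.pos wA mA hwm
    omega
  have wv3 := (r₁.adj w (sub wA) v₂ hv₂ (ne₂ wA)).1 hw.symm
  have mv4 := r₁.four_le (sub mA) hv₂ (ne₂ mA) (fun h => hfar m mK h.symm)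
  -- As `w` is within three of `v₂` and its neighbour `m` is not, `w` is at distance exactly three
  -- from `v₂`, and `m` lies on the other side.
  have mside : d₁ m v₂ = d₁ w v₂ + 1 := by
    have := r₁.metric.nbr_cases (sub wA) hv₂ (sub mA) wm
    omega
  obtain ⟨z', hz', a1, a2⟩ := r₁.metric.geod hv₂ 1 (sub wA) (by omega)
  obtain ⟨y', hy', b1, b2⟩ := r₁.metric.geod hv₂ 1 hz' (by omega)
  have hvv := r₁.metric.self v₂ hv₂
  have z'A : z' ∈ A := (hA z').2 ⟨hz', by rintro rfl; omega⟩
  have y'A : y' ∈ A := (hA y').2 ⟨hy', by rintro rfl; omega⟩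
  have adjv : ∀ {t}, t ∈ A → d₁ t v₂ ≤ 3 → H.Adj v₂ t := fun ht h =>
    ((r₁.adj _ (sub ht) v₂ hv₂ (ne₂ ht)).2 h).symm
  have z'v := adjv z'A (by omega)
  have y'v := adjv y'A (by omega)
  have hy'w : y' ≠ w := by rintro rfl; omega
  have hz'w : z' ≠ w := by rintro rfl; omega
  have hxz' : x ≠ z' := by
    rintro rfl
    have := (IsTreeMetric.sibling_iff h₁ h₂ hh e₁ e₂ y'A).1 ⟨b1, hy'w⟩
    exact hfar y' ((hK y' y'A).2 (by omega)) y'v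
  have yy' : d₁ y y' = 4 := h₁.dist_four wA xA yA z'A y'A (by omega) (by omega) e₁.hyw a1 b1 hy'w hxz'
  have wy' : d₁ w y' ≤ 2 := by
    have := h₁.tri w wA z' z'A y' y'A
    omega
  have wy : d₁ w y ≤ 2 := by
    have := h₁.tri w wA x xA y yA
    omega
  have near := (e₁.ball_two h₁ y'A).1 wy'
  have hsu : IsTreeMetric.Simp A d₁ u :=
    h₁.simp_of_farthest wA uA (by rintro rfl; omega) (fun t ht => by have := univ t ht; omega)
  have nu₁ : ¬ H.Adj v₁ u := by
    intro h
    have h1 := (hK u uA).1 h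
    rcases h₂.eq_or_adj zA uA h1 with rfl | h1
    · omega
    by_cases hum : u = m
    · subst hum; omega
    have := (IsTreeMetric.sibling_iff h₁ h₂ hh e₁ e₂ uA).2 ⟨h1, hum⟩
    have := h₁.tri w wA x xA u uA
    omega
  have nu₂ : ¬ H.Adj v₂ u := by
    intro h
    have h1 := (r₁.adj v₂ hv₂ u (sub uA) h.ne).1 h
    have := r₁.metric.split hv₂ _ (sub wA) (sub mA) (sub uA) rfl wm mside mu
    have := r₁.metric.comm v₂ hv₂ w (sub wA)
    omega
  have su : IsSimplicial H u := by
    intro a b ha hb hab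
    have memA : ∀ c, H.Adj u c → c ∈ A := fun c hc => (hA c).2
      ⟨by rintro rfl; exact nu₁ hc.symm, by rintro rfl; exact nu₂ hc.symm⟩
    exact (IsCubeRoot.mk h₁ fun a ha b hb => r₁.adj a (sub ha) b (sub hb)).adj_of_simp uA
      (memA a ha) (memA b hb) hsu ha hb hab
  obtain ⟨d₃, r₃⟩ := hroot u su
  have ne : ∀ {t}, d₁ w t ≤ 2 → t ∈ ({u}ᶜ : Set V) := by
    rintro t h rfl
    omega
  have mv₁ : v₁ ∈ ({u}ᶜ : Set V) := ((hA u).1 uA).1.symm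
  have mv₂ : v₂ ∈ ({u}ᶜ : Set V) := ((hA u).1 uA).2.symm
  have adj₃ : ∀ {a b}, a ∈ ({u}ᶜ : Set V) → b ∈ ({u}ᶜ : Set V) → H.Adj a b → d₃ a b ≤ 3 :=
    fun ha hb h => (r₃.adj _ ha _ hb h.ne).1 h
  have adj₁ : ∀ {a b}, a ∈ A → b ∈ A → a ≠ b → d₁ a b ≤ 3 → H.Adj a b :=
    fun ha hb hne h => (r₁.adj _ (sub ha) _ (sub hb) hne).2 h
  have my : y ∈ ({u}ᶜ : Set V) := ne wy
  have my' : y' ∈ ({u}ᶜ : Set V) := ne wy'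
  have mz : z ∈ ({u}ᶜ : Set V) := ne (by omega)
  have mz' : z' ∈ ({u}ᶜ : Set V) := ne (by omega)
  have mw : w ∈ ({u}ᶜ : Set V) := ne (by omega)
  have mm : m ∈ ({u}ᶜ : Set V) := ne (by omega)
  have hyz' : y ≠ z' := by rintro rfl; exact hfar y yK z'v
  have hy'z : y' ≠ z := by rintro rfl; exact hfar y' zK y'v
  have hy'm : y' ≠ m := by rintro rfl; exact hfar y' mK y'v
  have hyy' : y ≠ y' := by rintro rfl; exact hfar y yK y'v
  have fin := r₃.metric.adj_of_two_common mv₁ mv₂ my my' mz mm mw mz'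
    (r₃.seven_le mv₁ mv₂ hne hnadj fun t _ => hfar t)
    (adj₃ mv₁ my yK) (adj₃ mv₂ my' y'v) (adj₃ mv₁ mz zK) (adj₃ mv₁ mm mK) (adj₃ mv₂ mw hw)
    (adj₃ mv₂ mz' z'v) hzm hz'w.symm
    (adj₃ my mw (adj₁ yA wA e₁.hyw ((e₁.ball h₁ wA).2 (Or.inr (by omega)))))
    (adj₃ my mz' (adj₁ yA z'A hyz' ((e₁.ball h₁ z'A).2 (Or.inr (by omega)))))
    (adj₃ my' mz (adj₁ zA y'A hy'z.symm (near z zA wz)).symm)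
    (adj₃ my' mm (adj₁ mA y'A hy'm.symm (near m mA (by omega))).symm)
  have := (r₁.adj y (sub yA) y' (sub y'A) hyy').1 ((r₃.adj y my y' my' hyy').2 fin)
  omega

/-- A graph with two simplicial vertices at distance at least three is the cube of a tree, provided
its cards at simplicial vertices are cubes of sufficiently long trees. -/
theorem glue [Finite V] (hne : v₁ ≠ v₂) (hs₁ : IsSimplicial H v₁) (hs₂ : IsSimplicial H v₂)
    (hnadj : ¬ H.Adj v₁ v₂) (hfar : ∀ t, H.Adj v₁ t → ¬ H.Adj v₂ t)
    (hroot : ∀ v, IsSimplicial H v → ∃ d, IsCubeRoot H {v}ᶜ d ∧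
      ∃ a b, a ≠ v ∧ b ≠ v ∧ 6 ≤ d a b) : ∃ d', IsCubeRoot H Set.univ d' := by
  obtain ⟨d₁, r₁, p, q, hp, hq, hpq⟩ := hroot v₁ hs₁
  obtain ⟨d₂, r₂, -⟩ := hroot v₂ hs₂
  have m₁ : v₁ ∈ ({v₂}ᶜ : Set V) := hne
  have m₂ : v₂ ∈ ({v₁}ᶜ : Set V) := hne.symm
  -- neighbours of `v₁` and `v₂`
  obtain ⟨o, ho₁, ho₂⟩ : ∃ o, o ≠ v₁ ∧ o ≠ v₂ := by
    by_cases hpv : p = v₂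
    · refine ⟨q, hq, ?_⟩
      rintro rfl
      subst hpv
      have := r₁.metric.self p hp
      omega
    · exact ⟨p, hp, hpv⟩
  obtain ⟨k₁, hk₁, hk₁'⟩ : ∃ k, k ≠ v₂ ∧ H.Adj v₁ k := by
    obtain ⟨a, ha, g1, -⟩ := r₂.metric.step v₁ m₁ o ho₂ ho₁.symm
    have : v₁ ≠ a := by rintro rfl; have := r₂.metric.self v₁ ha; omega
    exact ⟨a, ha, (r₂.adj v₁ m₁ a ha this).2 (by omega)⟩
  obtain ⟨k₂, hk₂, hk₂'⟩ : ∃ k, k ≠ v₁ ∧ H.Adj v₂ k := by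
    obtain ⟨a, ha, g1, -⟩ := r₁.metric.step v₂ m₂ o ho₁ ho₂.symm
    have : v₂ ≠ a := by rintro rfl; have := r₁.metric.self v₂ ha; omega
    exact ⟨a, ha, (r₁.adj v₂ m₂ a ha this).2 (by omega)⟩
  have nk₂ : ¬ H.Adj v₁ k₂ := fun h => hfar k₂ h hk₂'
  have nk₁ : ¬ H.Adj v₂ k₁ := hfar k₁ hk₁'
  set A : Set V := {t | t ≠ v₁ ∧ t ≠ v₂} with hAdef
  have hA : ∀ t, t ∈ A ↔ t ≠ v₁ ∧ t ≠ v₂ := fun t => Iff.rfl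
  have sub₁ : ∀ {t}, t ∈ A → t ∈ ({v₁}ᶜ : Set V) := fun ht => ht.1
  have sub₂ : ∀ {t}, t ∈ A → t ∈ ({v₂}ᶜ : Set V) := fun ht => ht.2
  have q₁ : IsCubeRoot H A d₁ := r₁.delete m₂ hk₁'.ne' hk₁ nk₁ hs₂ (fun t => Iff.rfl)
  have q₂ : IsCubeRoot H A d₂ := r₂.delete m₁ hk₂'.ne' hk₂ nk₂ hs₁ (fun t => And.comm)
  have h₁ := q₁.metric
  have h₂ := q₂.metric
  have hh : ∀ a ∈ A, ∀ b ∈ A, d₁ a b ≤ 3 ↔ d₂ a b ≤ 3 := by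
    intro a ha b hb
    by_cases hab : a = b
    · subst hab
      rw [h₁.self a ha, h₂.self a ha]
    · rw [← q₁.adj a ha b hb hab, q₂.adj a ha b hb hab]
  -- Removing `v₂` costs at most one: an endpoint equal to `v₂` moves one step inwards. Five exceeds
  -- both three and `2 + 2`, as needed below.
  obtain ⟨p', p'A, q', q'A, hpq'⟩ : ∃ p ∈ A, ∃ q ∈ A, 5 ≤ d₁ p q := by
    have key : ∀ p q, p ≠ v₁ → q ≠ v₁ → 6 ≤ d₁ p q → q ≠ v₂ → ∃ p ∈ A, ∃ q ∈ A, 5 ≤ d₁ p q := by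
      intro p q hp hq hpq hqv
      by_cases hpv : p = v₂
      · subst hpv
        obtain ⟨b, hb, g1, g2⟩ := r₁.metric.geod hq 1 hp (by omega)
        refine ⟨b, ⟨hb, ?_⟩, q, ⟨hq, hqv⟩, by omega⟩
        rintro rfl
        have := r₁.metric.self b hb
        omega
      · exact ⟨p, ⟨hp, hpv⟩, q, ⟨hq, hqv⟩, by omega⟩
    by_cases hqv : q = v₂
    · refine key q p hq hp (by rw [r₁.metric.comm q hq p hp]; exact hpq) ?_
      rintro rfl
      subst hqv
      have := r₁.metric.self _ hp
      omega
    · exact key p q hp hq hpq hqv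
  have f₁ := r₂.four_le m₁ hk₂'.ne' hk₂.symm nk₂
  obtain ⟨y, z, e⟩ := r₂.metric.endLeaf_of_simp m₁ hk₂'.ne' f₁ (r₂.simp m₁ hs₁)
  have vy := e.hyx
  have yz := e.hxw
  have vz := e.hyw
  have cvy := r₂.metric.comm v₁ m₁ y e.hx
  have leaf_v := e.leaf_self r₂.metric
  have yA : y ∈ A := by
    refine ⟨?_, e.hx⟩
    rintro rfl
    have := r₂.metric.self y e.hx
    omega
  have zA : z ∈ A := ⟨vz.symm, e.hw⟩
  have czy := h₂.comm y yA z zA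
  have vdist : ∀ t ∈ A, d₂ v₁ t = d₂ y t + 1 := fun t ht =>
    r₂.metric.leaf_dist m₁ e.hx ht.2 leaf_v (Ne.symm ht.1)
  by_cases hsib : ∃ s ∈ A, d₂ y s = 1 ∧ s ≠ z
  · -- `v₁` has a twin
    obtain ⟨s, sA, ys, sz⟩ := hsib
    have leaf_s := e.leaf s sA.2 ys sz
    have csv := r₂.metric.comm v₁ m₁ s sA.2
    have vs := vdist s sA
    have htw : ∀ t, t ≠ v₁ → t ≠ v₂ → t ≠ s → (H.Adj v₁ t ↔ H.Adj s t) := by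
      intro t h1 h2 h3
      rw [r₂.adj v₁ m₁ t h2 h1.symm, r₂.adj s sA.2 t h2 h3.symm, vdist t ⟨h1, h2⟩,
        r₂.metric.leaf_dist sA.2 e.hx h2 leaf_s h3.symm]
    have vs' : H.Adj v₁ s := (r₂.adj v₁ m₁ s sA.2 sA.1.symm).2 (by omega)
    have nvs : ¬ H.Adj v₂ s := hfar s vs'
    have hk₂s : k₂ ≠ s := by rintro rfl; exact nvs hk₂'
    have htw' : ∀ t, t ≠ v₁ → t ≠ s → (H.Adj v₁ t ↔ H.Adj s t) := by
      intro t h1 h3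
      by_cases h2 : t = v₂
      · subst h2
        exact iff_of_false hnadj (fun h => nvs h.symm)
      · exact htw t h1 h2 h3
    refine r₁.glue_twin sA.1 ?_ vs' htw' ⟨k₂, hk₂, hk₂s, fun h => nk₂ ((htw' k₂ hk₂ hk₂s).2 h)⟩
    intro a b ha hb hab
    by_cases hav : a = v₁
    · subst hav
      exact (htw' b hab.symm hb.ne').2 hb
    by_cases hbv : b = v₁
    · subst hbv
      exact ((htw' a hab ha.ne').2 ha).symm
    exact hs₁ a b ((htw' a hav ha.ne').2 ha) ((htw' b hbv hb.ne').2 hb) hab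
  -- `y` is a leaf
  have leaf_y : ∀ s ∈ A, d₂ y s = 1 → s = z := by
    intro s sA ys
    by_contra hsz
    exact hsib ⟨s, sA, ys, hsz⟩
  have hK : ∀ t ∈ A, H.Adj v₁ t ↔ d₂ z t ≤ 1 := by
    intro t ht
    rw [r₂.adj v₁ m₁ t ht.2 ht.1.symm, vdist t ht]
    by_cases hty : y = t
    · subst hty
      have := h₂.self y yA
      omega
    · rw [h₂.leaf_dist yA zA ht leaf_y hty]
      omega
  have yK : H.Adj v₁ y := (hK y yA).2 (by omega)
  -- a neighbour of `z` away from `y`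
  have k₂A : k₂ ∈ A := ⟨hk₂, hk₂'.ne'⟩
  have zk : 2 ≤ d₂ z k₂ := by
    have := (hK k₂ k₂A).not.1 nk₂
    omega
  obtain ⟨m, mA, zm, mk⟩ := h₂.geod k₂A 1 zA (by omega)
  obtain ⟨m', m'A, mm', m'k⟩ := h₂.geod k₂A 1 mA (by omega)
  have hm'z : m' ≠ z := by rintro rfl; omega
  -- Does `z` have a non-leaf neighbour besides `m`? If not, `y` is an end leaf.
  by_cases hbr : ∃ s ∈ A, d₂ z s = 1 ∧ s ≠ m ∧ ∃ t ∈ A, d₂ s t = 1 ∧ t ≠ z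
  · obtain ⟨s, sA, zs, hsm, t, tA, st, htz⟩ := hbr
    obtain ⟨x, xA, l, lA, xl, leaf_l, hball⟩ := IsTreeMetric.exists_leaf_of_branching h₁ h₂ hh zA yA
      mA m'A sA tA (by omega) leaf_y zm mm' hm'z zs st htz (Ne.symm hsm)
    have clx := h₁.comm l lA x xA
    have far : ∀ t ∈ A, d₁ x t ≤ 1 → 4 ≤ d₁ t v₂ := by
      intro t tA ht
      have := hfar t ((hK t tA).2 ((hball t tA).1 ht))
      exact r₁.four_le tA.1 m₂ tA.2 (fun h => this h.symm)
    refine r₁.attach lA.1 fun t ht => ?_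
    by_cases htv : t = v₂
    · subst htv
      have := far l lA (by omega)
      exact iff_of_false hnadj (by omega)
    · have tA : t ∈ A := ⟨ht, htv⟩
      rw [hK t tA, ← hball t tA]
      by_cases hlt : l = t
      · subst hlt
        have := h₁.self l lA
        omega
      · rw [h₁.leaf_dist lA xA tA leaf_l hlt]
        omega
  · have e₂ : IsTreeMetric.EndLeaf A d₂ y z m := by
      refine ⟨yA, zA, mA, by omega, zm, ?_, ?_, ?_⟩
      · rintro rfl
        have := leaf_y m' m'A mm'
        exact hm'z this
      · intro s sA zs hsm t tA st
        by_contra htz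
        exact hbr ⟨s, sA, zs, hsm, t, tA, st, htz⟩
      -- With nothing at distance two beyond `m`, every vertex is within one of `m` or a neighbour
      -- of `z`. Then all `d₂`-distances are at most three, contradicting `5 ≤ d₁ p' q'`.
      · by_contra hno
        have near : ∀ t ∈ A, d₂ m t ≤ 1 ∨ d₂ z t = 1 := by
          intro t tA
          rcases h₂.nbr_cases zA tA mA zm with g | g
          · by_cases hzt : z = t
            · left
              subst hzt
              have := h₂.comm z zA m mA
              omega
            right
            obtain ⟨s, sA, g1, g2, -⟩ := h₂.step z zA t tA hzt
            have hsm : s ≠ m := by rintro rfl; omega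
            by_cases hst : s = t
            · exact hst ▸ g1
            obtain ⟨r, rA, k1, k2, -⟩ := h₂.step s sA t tA hst
            exact absurd ⟨s, sA, g1, hsm, r, rA, k1, by rintro rfl; omega⟩ hbr
          · left
            by_contra hgt
            obtain ⟨r, rA, k1, k2⟩ := h₂.geod tA 2 mA (by omega)
            refine hno ⟨r, rA, k1, ?_⟩
            have := h₂.tri z zA m mA r rA
            have := h₂.tri z zA r rA t tA
            omega
        have := (hh p' p'A q' q'A).2 (by
          have c1 := h₂.comm p' p'A m mA
          have c2 := h₂.comm p' p'A z zA
          have c3 := h₂.comm z zA m mA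
          have t1 := h₂.tri p' p'A m mA q' q'A
          have t2 := h₂.tri p' p'A z zA q' q'A
          have t3 := h₂.tri m mA z zA q' q'A
          have t4 := h₂.tri z zA m mA q' q'A
          rcases near p' p'A with g | g <;> rcases near q' q'A with g' | g' <;> omega)
        omega
    obtain ⟨t, tA, mt, zt⟩ := e₂.far
    have y4 : 4 ≤ d₁ y t := by
      have := (hh y yA t tA).not
      have hyt : y ≠ t := by rintro rfl; omega
      have := h₂.leaf_dist yA zA tA leaf_y hyt
      omega
    have sy : IsTreeMetric.Simp A d₁ y := by
      intro a ha b hb h1 h2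
      rw [hh a ha b hb]
      exact e₂.simp h₂ a ha b hb ((hh y yA a ha).1 h1) ((hh y yA b hb).1 h2)
    obtain ⟨x, w, e₁⟩ := h₁.endLeaf_of_simp yA tA y4 sy
    have hbig : ∃ t ∈ A, 3 ≤ d₁ w t := by
      by_contra hno
      push Not at hno
      have := hno p' p'A
      have := hno q' q'A
      have := h₁.tri p' p'A w e₁.hw q' q'A
      have := h₁.comm p' p'A w e₁.hw
      omega
    by_cases hw : H.Adj v₂ w
    · exact (false_of_center_adj r₁ hA hne h₁ h₂ hh e₁ e₂ hK hnadj hfar hbig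
        (fun v hv => (hroot v hv).imp fun d hd => hd.1) hw).elim
    · exact glue_of_center_not_adj r₁ hA hne h₁ h₂ hh e₁ e₂ hK hnadj hfar hbig hw

end Glue

end TreeCube

/-! ### Trees and tree metrics are the same -/

namespace TreeCube

/-- The distance function of a tree is a tree metric. -/
theorem isTreeMetric_dist {U : Type*} {T : SimpleGraph U} (hT : T.IsTree) :
    IsTreeMetric Set.univ T.dist where
  self x _ := SimpleGraph.dist_self
  eq_of_zero x _ y _ h := hT.connected.dist_eq_zero_iff.1 h
  comm x _ y _ := SimpleGraph.dist_comm
  tri x _ y _ z _ := hT.connected.dist_triangle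
  step c _ u _ hcu := by
    obtain ⟨p, hp, hlen⟩ := hT.connected.exists_path_of_dist c u
    have hnil : ¬ p.Nil := SimpleGraph.Walk.not_nil_of_ne hcu
    have htail : p.tail.length + 1 = p.length := SimpleGraph.Walk.length_tail_add_one hnil
    have h1 : T.dist p.snd u ≤ p.tail.length := SimpleGraph.dist_le _
    have hadj : T.dist c p.snd = 1 := SimpleGraph.dist_eq_one_iff_adj.2 (p.adj_snd hnil)
    have h2 : T.dist c u ≤ T.dist c p.snd + T.dist p.snd u := hT.connected.dist_triangle
    refine ⟨p.snd, trivial, hadj, by omega, fun b _ hb hne => ?_⟩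
    have hcb := SimpleGraph.dist_eq_one_iff_adj.1 hb
    -- A neighbour off the geodesic prolongs it to a path, which is the only path from `b` to `u`.
    have hnot : b ∉ p.support := fun hmem =>
      hne (hT.isAcyclic.eq_snd_of_adj_start hp hcb hmem)
    have hq : (SimpleGraph.Walk.cons hcb.symm p).IsPath := hp.cons hnot
    obtain ⟨q, hq', hqlen⟩ := hT.connected.exists_path_of_dist b u
    have := congrArg (fun r : T.Path b u => r.1.length)
      ((hT.isAcyclic.subsingleton_path b u).elim ⟨q, hq'⟩ ⟨_, hq⟩)
    simp only [SimpleGraph.Walk.length_cons] at this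
    omega

/-- The graph of pairs at distance one. -/
def unitGraph {V : Type*} {d : V → V → ℕ} (h : IsTreeMetric Set.univ d) : SimpleGraph V where
  Adj x y := d x y = 1
  symm := ⟨fun x y hxy => by rw [h.comm y trivial x trivial]; exact hxy⟩
  loopless := ⟨fun x hx => by have := h.self x trivial; omega⟩

section

variable {V : Type*} {d : V → V → ℕ} (h : IsTreeMetric Set.univ d)

theorem exists_walk_unitGraph (n : ℕ) : ∀ x y, d x y = n →
    ∃ p : (unitGraph h).Walk x y, p.length = n := by
  induction n with
  | zero =>
    intro x y hxy
    obtain rfl := h.eq_of_zero x trivial y trivial hxy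
    exact ⟨.nil, rfl⟩
  | succ n ih =>
    intro x y hxy
    have hne : x ≠ y := by rintro rfl; have := h.self x trivial; omega
    obtain ⟨a, -, h1, h2, -⟩ := h.step x trivial y trivial hne
    obtain ⟨p, hp⟩ := ih a y (by omega)
    exact ⟨.cons (show (unitGraph h).Adj x a from h1) p, by simp [hp]⟩

theorem le_length_unitGraph {x y : V} (p : (unitGraph h).Walk x y) : d x y ≤ p.length := by
  induction p with
  | nil => rw [h.self _ trivial]; exact Nat.zero_le _
  | @cons u v w huv p ih =>
    have h1 : d u v = 1 := huv
    have := h.tri u trivial v trivial w trivial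
    simp only [SimpleGraph.Walk.length_cons]
    omega

theorem edist_unitGraph (x y : V) : (unitGraph h).edist x y = d x y := by
  obtain ⟨p, hp⟩ := exists_walk_unitGraph h _ x y rfl
  refine le_antisymm (hp ▸ SimpleGraph.edist_le p) ?_
  obtain ⟨q, hq⟩ := SimpleGraph.Reachable.exists_walk_length_eq_edist ⟨p⟩
  rw [← hq]
  exact_mod_cast le_length_unitGraph h q

theorem isTree_unitGraph [Nonempty V] : (unitGraph h).IsTree where
  connected := SimpleGraph.Connected.mk fun x y => by
    obtain ⟨p, -⟩ := exists_walk_unitGraph h _ x y rfl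
    exact ⟨p⟩
  isAcyclic := by
    rw [SimpleGraph.isAcyclic_iff_forall_adj_isBridge]
    intro a b hab
    rw [SimpleGraph.isBridge_iff]
    rintro ⟨p⟩
    have hab1 : d a b = 1 := hab
    -- A walk that avoids the edge `ab` stays on the side of `a`: by `split`, only the edge `ab`
    -- itself changes sides.
    have key : ∀ {x y : V} (q : ((unitGraph h).deleteEdges {s(a, b)}).Walk x y),
        d b x = d a x + 1 → d b y = d a y + 1 := by
      intro x y q
      induction q with
      | nil => exact id
      | @cons u v w huv _ ih =>
        intro hu
        refine ih ?_
        rw [SimpleGraph.deleteEdges_adj] at huv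
        obtain ⟨h1, h2⟩ := huv
        have huv1 : d u v = 1 := h1
        rcases h.nbr_cases (c := a) trivial (u := v) trivial trivial hab1 with g | g
        · exact g
        · have := h.split trivial _ (u := u) (c := a) (b := b) (v := v) trivial trivial trivial rfl
            hab1 hu g
          have hua := h.eq_of_zero u trivial a trivial (by omega)
          have hbv := h.eq_of_zero b trivial v trivial (by omega)
          subst hua hbv
          exact absurd rfl h2
    have := key p (by rw [h.self a trivial, h.comm b trivial a trivial]; omega)
    rw [h.self b trivial] at this
    omega

end

theorem isCubeOfTree_iff {V : Type*} (G : SimpleGraph V) [Nonempty V] :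
    IsCubeOfTree G ↔ ∃ d, IsCubeRoot G Set.univ d := by
  constructor
  · rintro ⟨U, T, hT, ⟨e⟩⟩
    refine ⟨fun x y => T.dist (e x) (e y), (isTreeMetric_dist hT).comap e
      (Set.bijOn_univ.2 e.bijective), fun x _ y _ hxy => ?_⟩
    rw [← e.map_rel_iff]
    change (e x ≠ e y ∧ T.edist (e x) (e y) ≤ (3 : ℕ)) ↔ _
    rw [← (hT.connected (e x) (e y)).coe_dist_eq_edist, Nat.cast_le]
    exact and_iff_right (e.injective.ne hxy)
  · rintro ⟨d, r⟩
    refine ⟨V, unitGraph r.metric, isTree_unitGraph r.metric, ⟨⟨Equiv.refl V, ?_⟩⟩⟩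
    intro x y
    change (x ≠ y ∧ (unitGraph r.metric).edist x y ≤ (3 : ℕ)) ↔ _
    rw [edist_unitGraph, Nat.cast_le]
    constructor
    · rintro ⟨hxy, h3⟩
      exact (r.adj x trivial y trivial hxy).2 h3
    · intro hxy
      exact ⟨hxy.ne, (r.adj x trivial y trivial hxy.ne).1 hxy⟩

end TreeCube

/-! ### Simplicial vertices at distance at least three -/

namespace TreeCube

section FarPair

variable {V : Type*} {H : SimpleGraph V} {A : Set V} {d : V → V → ℕ}

theorem exists_max_pair [Finite V] (d : V → V → ℕ) (hA : A.Nonempty) :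
    ∃ a ∈ A, ∃ b ∈ A, ∀ s ∈ A, ∀ t ∈ A, d s t ≤ d a b := by
  obtain ⟨⟨a, b⟩, ⟨ha, hb⟩, hmax⟩ := Set.exists_max_image (A ×ˢ A) (fun p => d p.1 p.2)
    (Set.toFinite _) (hA.prod hA)
  exact ⟨a, ha, b, hb, fun s hs t ht => hmax (s, t) ⟨hs, ht⟩⟩

/-- The midpoint of a longest geodesic works: it lies between `t` and one of the two ends, and
maximality bounds its distance to `t` by half the diameter, rounded up. -/
theorem IsTreeMetric.exists_center [Finite V] (h : IsTreeMetric A d) (hA : A.Nonempty)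
    (h6 : ∀ s ∈ A, ∀ t ∈ A, d s t ≤ 6) : ∃ c ∈ A, ∀ t ∈ A, d c t ≤ 3 := by
  obtain ⟨a, ha, b, hb, hmax⟩ := exists_max_pair d hA
  have hab := h6 a ha b hb
  obtain ⟨c, hc, h1, h2⟩ := h.geod hb (d a b / 2) ha (by omega)
  have cac := h.comm a ha c hc
  refine ⟨c, hc, fun t ht => ?_⟩
  have cct := h.comm c hc t ht
  rcases h.branch hc ht ha with g | ⟨e, he, e1, e2, e3⟩
  · have := hmax t ht a ha
    omega
  rcases h.branch hc ht hb with g | ⟨f, hf, f1, f2, f3⟩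
  · have := hmax t ht b hb
    omega
  have := h.nbr_unique hc ht he hf e1 f1 e2 f2
  subst this
  have := h.tri a ha e he b hb
  have := h.comm a ha e he
  omega

theorem IsTreeMetric.exists_far_simp [Finite V] (h : IsTreeMetric A d)
    (hfar : ∃ s ∈ A, ∃ t ∈ A, 7 ≤ d s t) :
    ∃ a ∈ A, ∃ b ∈ A, Simp A d a ∧ Simp A d b ∧ 7 ≤ d a b := by
  obtain ⟨s, hs, t, ht, hst⟩ := hfar
  obtain ⟨a, ha, b, hb, hmax⟩ := exists_max_pair d ⟨s, hs⟩
  have h7 := hmax s hs t ht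
  have hne : a ≠ b := by rintro rfl; have := h.self a ha; omega
  refine ⟨a, ha, b, hb, h.simp_of_farthest hb ha hne fun u hu => ?_,
    h.simp_of_farthest ha hb hne.symm fun u hu => hmax a ha u hu, by omega⟩
  rw [h.comm b hb a ha]
  exact hmax b hb u hu

theorem IsCubeRoot.isSimplicial_of_not_adj {v u : V} (r : IsCubeRoot H {v}ᶜ d) (hu : u ≠ v)
    (hs : IsTreeMetric.Simp {v}ᶜ d u) (hnadj : ¬ H.Adj v u) : IsSimplicial H u := by
  intro a b ha hb hab
  have mem : ∀ c, H.Adj u c → c ∈ ({v}ᶜ : Set V) := by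
    rintro c hc rfl
    exact hnadj hc.symm
  exact r.adj_of_simp hu (mem a ha) (mem b hb) hs ha hb hab

/-- Two simplicial vertices at distance at least three. -/
def HasFarPair (H : SimpleGraph V) : Prop :=
  ∃ v₁ v₂, v₁ ≠ v₂ ∧ IsSimplicial H v₁ ∧ IsSimplicial H v₂ ∧ ¬ H.Adj v₁ v₂ ∧
    ∀ t, H.Adj v₁ t → ¬ H.Adj v₂ t

/-- The ends of a longest geodesic in the root of the card are candidates. If `v` is adjacent to
neither, they stay simplicial in `H`. If `v` is adjacent to one, every other neighbour of the
simplicial `v` is adjacent to it as well, so `v` inherits its remoteness. -/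
theorem hasFarPair_of_card_root [Finite V] {v : V} (hv : IsSimplicial H v)
    (r : IsCubeRoot H {v}ᶜ d) (hfar : ∃ s ≠ v, ∃ t ≠ v, 7 ≤ d s t) : HasFarPair H := by
  obtain ⟨a, ha, b, hb, sa, sb, hab⟩ := r.metric.exists_far_simp hfar
  have hne : a ≠ b := by rintro rfl; have := r.metric.self a ha; omega
  have nab : ¬ H.Adj a b := r.not_adj ha hb (by omega)
  have nc : ∀ t, t ≠ v → H.Adj a t → ¬ H.Adj b t := fun t ht => r.no_common ha hb ht hab
  -- if `v` is adjacent to one of the two, it replaces that one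
  have key : ∀ a b, a ≠ v → b ≠ v → a ≠ b → IsTreeMetric.Simp {v}ᶜ d b → ¬ H.Adj a b →
      (∀ t, t ≠ v → H.Adj a t → ¬ H.Adj b t) → H.Adj v a → HasFarPair H := by
    intro a b ha hb hne sb nab nc hva
    have nvb : ¬ H.Adj v b := fun h => nab (hv a b hva h hne)
    refine ⟨v, b, hb.symm, hv, r.isSimplicial_of_not_adj hb sb nvb, nvb, fun t hvt hbt => ?_⟩
    by_cases hta : a = t
    · subst hta
      exact nab hbt.symm
    · exact nc t hvt.ne' (hv a t hva hvt hta) hbt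
  by_cases hva : H.Adj v a
  · exact key a b ha hb hne sb nab nc hva
  by_cases hvb : H.Adj v b
  · exact key b a hb ha hne.symm sa (fun h => nab h.symm) (fun t ht h1 h2 => nc t ht h2 h1) hvb
  · refine ⟨a, b, hne, r.isSimplicial_of_not_adj ha sa hva, r.isSimplicial_of_not_adj hb sb hvb,
      nab, fun t hat => nc t ?_ hat⟩
    rintro rfl
    exact hva hat.symm

/-- Let `w` be a neighbour of `v₁` equal or adjacent to `v₂`. A vertex farthest from `w` in the root
of `H - v₁` is not adjacent to `w`, hence not to `v₁`, so it is simplicial in `H`. It is neither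
`v₁` nor `v₂`. -/
theorem hasFarPair_of_two [Finite V] {v₁ v₂ : V} (hne : v₁ ≠ v₂) (hs₁ : IsSimplicial H v₁)
    (hs₂ : IsSimplicial H v₂) (hall : ∀ v, IsSimplicial H v → v = v₁ ∨ v = v₂)
    (hU : ∀ w, ∃ t, t ≠ w ∧ ¬ H.Adj w t) (r : IsCubeRoot H {v₁}ᶜ d) : HasFarPair H := by
  have key : ∀ w, H.Adj v₁ w → ¬ (w = v₂ ∨ H.Adj v₂ w) := by
    intro w hw hw₂
    have hwv : w ∈ ({v₁}ᶜ : Set V) := hw.ne'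
    obtain ⟨t, htw, ht⟩ := hU w
    have htv : t ≠ v₁ := by rintro rfl; exact ht hw.symm
    obtain ⟨u, hu, hmax⟩ := Set.exists_max_image ({v₁}ᶜ : Set V) (d w) (Set.toFinite _) ⟨w, hwv⟩
    have h4 : 4 ≤ d w u := (r.four_le hwv htv htw.symm ht).trans (hmax t htv)
    have huw : u ≠ w := by rintro rfl; have := r.metric.self u hwv; omega
    have nwu : ¬ H.Adj w u := r.not_adj hwv hu h4
    have nu : ¬ H.Adj v₁ u := fun h => nwu (hs₁ w u hw h huw.symm)
    rcases hall u (r.isSimplicial_of_not_adj hu (r.metric.simp_of_farthest hwv hu huw hmax) nu)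
      with rfl | rfl
    · exact hu rfl
    · rcases hw₂ with rfl | hw₂
      · exact huw rfl
      · exact nwu hw₂.symm
  exact ⟨v₁, v₂, hne, hs₁, hs₂, fun h => key v₂ h (Or.inl rfl),
    fun t h1 h2 => key t h1 (Or.inr h2)⟩

end FarPair

/-! ### Matching cards -/

section Deck

variable {V W : Type*} {G : SimpleGraph V} {H : SimpleGraph W}

/-- `σ` matches the cards of `G` with isomorphic cards of `H`. -/
def MatchesCards (G : SimpleGraph V) (H : SimpleGraph W) (σ : V ≃ W) : Prop :=
  ∀ x, ∃ φ : V ≃ W, φ x = σ x ∧ ∀ a b, a ≠ x → b ≠ x → (G.Adj a b ↔ H.Adj (φ a) (φ b))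

theorem exists_equiv_of_map_eq [Fintype V] [Fintype W] {γ : Type*} (f : V → γ) (g : W → γ)
    (h : (Finset.univ : Finset V).val.map f = (Finset.univ : Finset W).val.map g) :
    ∃ σ : V ≃ W, ∀ x, g (σ x) = f x := by
  classical
  have hc : ∀ c, Nonempty ({a // f a = c} ≃ {b // g b = c}) := by
    intro c
    refine Fintype.card_eq.1 ?_
    have := congrArg (Multiset.count c) h
    rw [Multiset.count_map, Multiset.count_map] at this
    rw [Fintype.card_subtype, Fintype.card_subtype]
    simp only [Finset.card_def, Finset.filter_val]
    simpa only [eq_comm] using this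
  have e := fun c => (hc c).some
  exact ⟨Equiv.ofFiberEquiv e, fun x => Equiv.ofFiberEquiv_map e x⟩

theorem exists_matchesCards [Fintype V] [Fintype W] (h : deck G = deck H) :
    ∃ σ, MatchesCards G H σ := by
  classical
  obtain ⟨σ, hσ⟩ := exists_equiv_of_map_eq (card G) (card H) h
  refine ⟨σ, fun x => ?_⟩
  obtain ⟨e⟩ := (unlabelled_eq_iff _ _).1 (hσ x).symm
  -- The isomorphism of the cards is extended to the deleted vertices by `x ↦ σ x`.
  let o : {y // ¬ y ∈ {y | y ≠ x}} ≃ {y // ¬ y ∈ {y | y ≠ σ x}} :=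
    { toFun := fun _ => ⟨σ x, by simp⟩
      invFun := fun _ => ⟨x, by simp⟩
      left_inv := fun y => Subtype.ext (not_not.1 y.2).symm
      right_inv := fun y => Subtype.ext (not_not.1 y.2).symm }
  refine ⟨(Equiv.sumCompl _).symm.trans ((Equiv.sumCongr e.toEquiv o).trans (Equiv.sumCompl _)),
    ?_, ?_⟩
  · simp [Equiv.sumCompl_symm_apply_of_neg, o]
  · intro a b ha hb
    have := e.map_rel_iff (a := ⟨a, ha⟩) (b := ⟨b, hb⟩)
    simp only [SimpleGraph.comap_adj, Function.Embedding.subtype_apply] at this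
    simp [ha, hb, ← this]

/-! ### Kelly's lemma for cliques -/

/-- The number of `k`-cliques through `x`. -/
noncomputable def cliquesAt [Fintype V] (G : SimpleGraph V) (k : ℕ) (x : V) : ℕ :=
  open Classical in (Finset.univ.filter fun s : Finset V => G.IsNClique k s ∧ x ∈ s).card

theorem sum_cliques_avoiding [Fintype V] (G : SimpleGraph V) (k : ℕ) : open Classical in
    ∑ x, (Finset.univ.filter fun s : Finset V => G.IsNClique k s ∧ x ∉ s).card =
      (Finset.univ.filter fun s : Finset V => G.IsNClique k s).card * (Fintype.card V - k) := by
  classical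
  have := Finset.sum_card_bipartiteAbove_eq_sum_card_bipartiteBelow
    (s := (Finset.univ : Finset V)) (t := Finset.univ.filter fun s : Finset V => G.IsNClique k s)
    (fun x s => x ∉ s)
  simp only [Finset.bipartiteAbove, Finset.bipartiteBelow, Finset.filter_filter] at this
  rw [this, Finset.sum_const_nat]
  intro s hs
  have hs' := (Finset.mem_filter.1 hs).2.card_eq
  rw [← hs', ← Finset.card_compl]
  congr 1
  ext x
  simp

/-- The card at `x` shows the `k`-cliques avoiding `x`. Summed over all vertices these count each
clique `n - k` times, with `n` the number of vertices; for `k < n` this gives the total, and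
subtraction gives the cliques through `x`. -/
theorem MatchesCards.cliquesAt_eq [Fintype V] [Fintype W] {σ : V ≃ W} (hσ : MatchesCards G H σ)
    {k : ℕ} (hk : k < Fintype.card V) (x : V) : cliquesAt G k x = cliquesAt H k (σ x) := by
  classical
  have avoid : ∀ x, (Finset.univ.filter fun s : Finset V => G.IsNClique k s ∧ x ∉ s).card =
      (Finset.univ.filter fun s : Finset W => H.IsNClique k s ∧ σ x ∉ s).card := by
    intro x
    obtain ⟨φ, hφ, hadj⟩ := hσ x
    refine Finset.card_equiv φ.finsetCongr fun s => ?_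
    simp only [Finset.mem_filter, Finset.mem_univ, true_and, Equiv.finsetCongr_apply,
      SimpleGraph.isNClique_iff, Finset.card_map, ← hφ]
    have hmem : φ x ∉ s.map φ.toEmbedding ↔ x ∉ s := by simp
    rw [hmem]
    refine and_congr_left fun hx => and_congr_left fun _ => ?_
    rw [SimpleGraph.isClique_iff, SimpleGraph.isClique_iff, Finset.coe_map,
      Equiv.coe_toEmbedding, Set.InjOn.pairwise_image φ.injective.injOn]
    refine forall₂_congr fun a ha => forall₂_congr fun b hb => forall_congr' fun _ => ?_
    exact hadj a b (fun e => hx (e ▸ ha)) (fun e => hx (e ▸ hb))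
  have total : (Finset.univ.filter fun s : Finset V => G.IsNClique k s).card =
      (Finset.univ.filter fun s : Finset W => H.IsNClique k s).card := by
    have h1 := sum_cliques_avoiding G k
    have h2 := sum_cliques_avoiding H k
    have h3 : ∑ x, (Finset.univ.filter fun s : Finset V => G.IsNClique k s ∧ x ∉ s).card =
        ∑ y, (Finset.univ.filter fun s : Finset W => H.IsNClique k s ∧ y ∉ s).card :=
      Fintype.sum_equiv σ _ _ avoid
    rw [← Fintype.card_congr σ, ← h3] at h2
    exact Nat.eq_of_mul_eq_mul_right (by omega) (h1.symm.trans h2)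
  have h1 := Finset.card_filter_add_card_filter_not
    (s := Finset.univ.filter fun s : Finset V => G.IsNClique k s) (fun s => x ∈ s)
  have h2 := Finset.card_filter_add_card_filter_not
    (s := Finset.univ.filter fun s : Finset W => H.IsNClique k s) (fun s => σ x ∈ s)
  simp only [Finset.filter_filter] at h1 h2
  have h3 := avoid x
  unfold cliquesAt
  omega

/-- The neighbourhood of a vertex as a finite set. -/
noncomputable def nbrs [Fintype V] (G : SimpleGraph V) (x : V) : Finset V :=
  open Classical in Finset.univ.filter fun y => G.Adj x y

theorem mem_nbrs [Fintype V] {x y : V} : y ∈ nbrs G x ↔ G.Adj x y := by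
  classical
  simp [nbrs]

theorem cliquesAt_two [Fintype V] (x : V) : cliquesAt G 2 x = (nbrs G x).card := by
  classical
  symm
  refine Finset.card_bij (fun y _ => {x, y}) ?_ ?_ ?_
  · intro y hy
    have := mem_nbrs.1 hy
    simp [SimpleGraph.isNClique_iff, this, this.ne,
      Finset.card_pair this.ne]
  · intro y hy z hz hyz
    have h1 := (mem_nbrs.1 hy).ne
    have : y ∈ ({x, z} : Finset V) := hyz ▸ by simp
    simpa [h1.symm] using this
  · intro s hs
    obtain ⟨-, hs, hx⟩ := Finset.mem_filter.1 hs
    obtain ⟨a, b, hab, rfl⟩ := Finset.card_eq_two.1 hs.card_eq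
    have hadj : G.Adj a b := hs.isClique (by simp) (by simp) hab
    rcases Finset.mem_insert.1 hx with rfl | hx
    · exact ⟨b, mem_nbrs.2 hadj, rfl⟩
    · obtain rfl := Finset.mem_singleton.1 hx
      exact ⟨a, mem_nbrs.2 hadj.symm, Finset.pair_comm _ _⟩

theorem isSimplicial_iff_cliquesAt [Fintype V] (x : V) :
    IsSimplicial G x ↔ 0 < cliquesAt G ((nbrs G x).card + 1) x := by
  classical
  have hx : x ∉ nbrs G x := fun h => (mem_nbrs.1 h).ne rfl
  rw [cliquesAt, Finset.card_pos]
  constructor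
  · intro hs
    refine ⟨insert x (nbrs G x), ?_⟩
    rw [Finset.mem_filter, SimpleGraph.isNClique_iff, Finset.card_insert_of_notMem hx]
    refine ⟨Finset.mem_univ _, ⟨?_, rfl⟩, Finset.mem_insert_self _ _⟩
    rw [Finset.coe_insert, SimpleGraph.isClique_insert]
    exact ⟨fun a ha b hb hab => hs a b (mem_nbrs.1 ha) (mem_nbrs.1 hb) hab,
      fun b hb _ => mem_nbrs.1 hb⟩
  · rintro ⟨s, hs⟩
    obtain ⟨-, hs, hxs⟩ := Finset.mem_filter.1 hs
    have hsub : s ⊆ insert x (nbrs G x) := by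
      intro y hy
      by_cases hyx : x = y
      · simp [hyx]
      · exact Finset.mem_insert_of_mem (mem_nbrs.2 (hs.isClique hxs hy hyx))
    have heq := Finset.eq_of_subset_of_card_le hsub
      (by rw [Finset.card_insert_of_notMem hx, hs.card_eq])
    intro a b ha hb hab
    refine hs.isClique ?_ ?_ hab
    · rw [heq]; simp [mem_nbrs, ha]
    · rw [heq]; simp [mem_nbrs, hb]

/-- A vertex adjacent to all other vertices. -/
def IsUniversal (G : SimpleGraph V) (x : V) : Prop := ∀ t, t ≠ x → G.Adj x t

theorem card_nbrs_lt [Fintype V] (x : V) : (nbrs G x).card < Fintype.card V := by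
  rw [← Finset.card_univ]
  exact Finset.card_lt_card (Finset.ssubset_univ_iff.2 fun h =>
    (mem_nbrs.1 (h ▸ Finset.mem_univ x)).ne rfl)

theorem isUniversal_iff [Fintype V] (x : V) :
    IsUniversal G x ↔ (nbrs G x).card + 1 = Fintype.card V := by
  classical
  have hx : x ∉ nbrs G x := fun h => (mem_nbrs.1 h).ne rfl
  rw [← Finset.card_insert_of_notMem hx, Finset.card_eq_iff_eq_univ, Finset.eq_univ_iff_forall]
  refine forall_congr' fun t => ?_
  rw [Finset.mem_insert, mem_nbrs]
  tauto

variable [Fintype V] [Fintype W] {σ : V ≃ W}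

theorem MatchesCards.card_nbrs (hσ : MatchesCards G H σ) (hV : 3 ≤ Fintype.card V) (x : V) :
    (nbrs G x).card = (nbrs H (σ x)).card := by
  rw [← cliquesAt_two, ← cliquesAt_two]
  exact hσ.cliquesAt_eq (by omega) x

theorem MatchesCards.isUniversal (hσ : MatchesCards G H σ) (hV : 3 ≤ Fintype.card V) (x : V) :
    IsUniversal G x ↔ IsUniversal H (σ x) := by
  rw [isUniversal_iff, isUniversal_iff, hσ.card_nbrs hV, Fintype.card_congr σ]

/-- A simplicial vertex lies in a clique of size its degree plus one; non-universality keeps this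
size below the number of vertices. -/
theorem MatchesCards.isSimplicial (hσ : MatchesCards G H σ) (hV : 3 ≤ Fintype.card V) {x : V}
    (hx : ¬ IsUniversal G x) : IsSimplicial G x ↔ IsSimplicial H (σ x) := by
  have h1 := card_nbrs_lt (G := G) x
  rw [isUniversal_iff] at hx
  rw [isSimplicial_iff_cliquesAt, isSimplicial_iff_cliquesAt, hσ.cliquesAt_eq (by omega),
    hσ.card_nbrs hV]

/-! ### Recognition -/

theorem MatchesCards.exists_root (hσ : MatchesCards G H σ) (hV : 3 ≤ Fintype.card V)
    {d : V → V → ℕ} (r : IsCubeRoot G Set.univ d) : ∃ d', IsCubeRoot H Set.univ d' := by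
  by_cases hU : ∃ x, IsUniversal G x
  · obtain ⟨x, hx⟩ := hU
    have hx' := (hσ.isUniversal hV x).1 hx
    obtain ⟨φ, hφ, hadj⟩ := hσ x
    have hiso : ∀ a b, a ≠ b → (G.Adj a b ↔ H.Adj (φ a) (φ b)) := by
      intro a b hab
      by_cases ha : a = x
      · subst ha
        rw [hφ]
        exact iff_of_true (hx b hab.symm) (hx' _ (hφ ▸ φ.injective.ne hab.symm))
      by_cases hb : b = x
      · subst hb
        rw [hφ]
        exact iff_of_true (hx a hab).symm (hx' _ (hφ ▸ φ.injective.ne hab)).symm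
      exact hadj a b ha hb
    refine ⟨fun s t => d (φ.symm s) (φ.symm t), r.metric.comap _
      (Set.bijOn_univ.2 φ.symm.bijective), fun s _ t _ hst => ?_⟩
    rw [← r.adj _ trivial _ trivial (φ.symm.injective.ne hst), hiso _ _ (φ.symm.injective.ne hst),
      φ.apply_symm_apply, φ.apply_symm_apply]
  have nU : ∀ x, ¬ IsUniversal G x := fun x hx => hU ⟨x, hx⟩
  have non : ∀ x, ∃ t, t ≠ x ∧ ¬ G.Adj x t := by
    intro x
    have := nU x
    unfold IsUniversal at this
    push Not at this
    exact this
  have nonH : ∀ w, ∃ t, t ≠ w ∧ ¬ H.Adj w t := by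
    intro w
    have := (hσ.isUniversal hV (σ.symm w)).not.1 (nU _)
    rw [σ.apply_symm_apply] at this
    unfold IsUniversal at this
    push Not at this
    exact this
  -- If all distances are at most six, the centre is universal.
  have hpair : ∃ s ∈ (Set.univ : Set V), ∃ t ∈ (Set.univ : Set V), 7 ≤ d s t := by
    by_contra hno
    have : Nonempty V := Fintype.card_pos_iff.1 (by omega)
    obtain ⟨c, -, hc⟩ := r.metric.exists_center Set.univ_nonempty fun s hs t ht => by
      by_contra h7
      exact hno ⟨s, hs, t, ht, by omega⟩
    exact nU c fun t ht => (r.adj c trivial t trivial ht.symm).2 (hc t trivial)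
  obtain ⟨l₁, -, l₂, -, s₁, s₂, h7⟩ := r.metric.exists_far_simp hpair
  have simpG : ∀ l, IsTreeMetric.Simp Set.univ d l → IsSimplicial G l := fun l hl a b ha hb hab =>
    r.adj_of_simp trivial trivial trivial hl ha hb hab
  have hl : l₁ ≠ l₂ := by rintro rfl; have := r.metric.self l₁ trivial; omega
  -- roots of the cards at simplicial vertices
  have cardRoot : ∀ x, IsSimplicial G x → ∃ (φ : V ≃ W), φ x = σ x ∧
      IsCubeRoot H {σ x}ᶜ (fun s t => d (φ.symm s) (φ.symm t)) := by
    intro x hx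
    obtain ⟨φ, hφ, hadj⟩ := hσ x
    obtain ⟨u, hux, hu⟩ := non x
    have rx : IsCubeRoot G {x}ᶜ d := r.delete trivial trivial hux hu hx (by simp)
    have hmem : ∀ {s}, s ∈ ({σ x}ᶜ : Set W) → φ.symm s ∈ ({x}ᶜ : Set V) := by
      rintro s hs h
      refine hs ?_
      rw [Set.mem_singleton_iff] at h ⊢
      rw [← hφ, ← h, φ.apply_symm_apply]
    refine ⟨φ, hφ, rx.metric.comap _ ⟨fun s hs => hmem hs, φ.symm.injective.injOn, fun a ha =>
      ⟨φ a, ?_, φ.symm_apply_apply a⟩⟩, fun s hs t ht hst => ?_⟩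
    · rw [Set.mem_compl_iff, Set.mem_singleton_iff, ← hφ]
      exact φ.injective.ne ha
    · rw [← rx.adj _ (hmem hs) _ (hmem ht) (φ.symm.injective.ne hst), hadj _ _ (hmem hs) (hmem ht),
        φ.apply_symm_apply, φ.apply_symm_apply]
  have cardPair : ∀ x, IsSimplicial G x → ∀ (n : ℕ), (∃ s ≠ x, ∃ t ≠ x, n ≤ d s t) →
      ∃ d', IsCubeRoot H {σ x}ᶜ d' ∧ ∃ s ≠ σ x, ∃ t ≠ σ x, n ≤ d' s t := by
    rintro x hx n ⟨s, hs, t, ht, hst⟩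
    obtain ⟨φ, hφ, rφ⟩ := cardRoot x hx
    refine ⟨_, rφ, φ s, hφ ▸ φ.injective.ne hs, φ t, hφ ▸ φ.injective.ne ht, ?_⟩
    rw [φ.symm_apply_apply, φ.symm_apply_apply]
    exact hst
  -- Deleting an end of the long geodesic shortens it by one.
  have six : ∀ x, ∃ s ≠ x, ∃ t ≠ x, 6 ≤ d s t := by
    have key : ∀ l₁ l₂, 7 ≤ d l₁ l₂ → ∃ s ≠ l₁, ∃ t ≠ l₁, 6 ≤ d s t := by
      intro l₁ l₂ h7
      obtain ⟨b, hb, g1, g2⟩ := r.metric.geod (v := l₂) trivial 1 (u := l₁) trivial (by omega)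
      have h0 := r.metric.self l₁ trivial
      exact ⟨b, by rintro rfl; omega, l₂, by rintro rfl; omega, by omega⟩
    intro x
    by_cases h1 : l₁ = x
    · subst h1; exact key l₁ l₂ h7
    by_cases h2 : l₂ = x
    · subst h2; exact key l₂ l₁ (by rw [r.metric.comm l₂ trivial l₁ trivial]; exact h7)
    exact ⟨l₁, h1, l₂, h2, by omega⟩
  have simpH : ∀ v, IsSimplicial H v → IsSimplicial G (σ.symm v) := fun v hv =>
    (hσ.isSimplicial hV (nU _)).2 (by rwa [σ.apply_symm_apply])
  have hroot : ∀ v, IsSimplicial H v → ∃ d, IsCubeRoot H {v}ᶜ d ∧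
      ∃ a b, a ≠ v ∧ b ≠ v ∧ 6 ≤ d a b := by
    intro v hv
    obtain ⟨d', r', s, hs, t, ht, hst⟩ := cardPair _ (simpH v hv) 6 (six _)
    rw [σ.apply_symm_apply] at r' hs ht
    exact ⟨d', r', s, t, hs, ht, hst⟩
  have hfar : HasFarPair H := by
    have simpσ : ∀ l, IsTreeMetric.Simp Set.univ d l → IsSimplicial H (σ l) := fun l hl =>
      (hσ.isSimplicial hV (nU _)).1 (simpG l hl)
    -- The card at a third simplicial vertex still contains both `l₁` and `l₂`; without one, `l₁`
    -- and `l₂` are matched with the only two simplicial vertices of `H`.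
    by_cases hthird : ∃ x, IsSimplicial G x ∧ l₁ ≠ x ∧ l₂ ≠ x
    · obtain ⟨x, hx, h1, h2⟩ := hthird
      obtain ⟨d', r', hp⟩ := cardPair x hx 7 ⟨l₁, h1, l₂, h2, h7⟩
      exact hasFarPair_of_card_root ((hσ.isSimplicial hV (nU _)).1 hx) r' hp
    · obtain ⟨d', r', -⟩ := hroot _ (simpσ l₁ s₁)
      refine hasFarPair_of_two (σ.injective.ne hl) (simpσ l₁ s₁) (simpσ l₂ s₂) ?_ nonH r'
      intro v hv
      by_contra hno
      push Not at hno
      refine hthird ⟨σ.symm v, simpH v hv, ?_, ?_⟩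
      · rintro rfl; exact hno.1 (σ.apply_symm_apply v).symm
      · rintro rfl; exact hno.2 (σ.apply_symm_apply v).symm
  obtain ⟨v₁, v₂, hne, t₁, t₂, hnadj, hcom⟩ := hfar
  exact glue hne t₁ t₂ hnadj hcom hroot

theorem isCubeOfTree_of_deck_eq (hV : 3 ≤ Fintype.card V) (h : deck G = deck H)
    (hG : IsCubeOfTree G) : IsCubeOfTree H := by
  obtain ⟨σ, hσ⟩ := exists_matchesCards h
  have : Nonempty V := Fintype.card_pos_iff.1 (by omega)
  have : Nonempty W := σ.nonempty_congr.1 this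
  obtain ⟨d, r⟩ := (isCubeOfTree_iff G).1 hG
  exact (isCubeOfTree_iff H).2 (hσ.exists_root hV r)

end Deck

end TreeCube

theorem lemma4p2 {V : Type*} {W : Type*} [Fintype V] [Fintype W]
    (G : SimpleGraph V) (H : SimpleGraph W)
    (hV : 3 ≤ Fintype.card V)
    (hdeck : TreeCube.deck G = TreeCube.deck H) :
    TreeCube.IsCubeOfTree G ↔ TreeCube.IsCubeOfTree H := by
  refine ⟨TreeCube.isCubeOfTree_of_deck_eq hV hdeck,
    TreeCube.isCubeOfTree_of_deck_eq ?_ hdeck.symm⟩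
  obtain ⟨σ, -⟩ := TreeCube.exists_matchesCards hdeck
  rwa [← Fintype.card_congr σ]
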